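/- **Setting.** Let $k\ge 2$ be an even integer. A $k$-XOR instance $\Phi$ on $n$ variables is a set of $m$ constraints $\prod_{i=1}^k x_{s_i}=\eta_S$ with distinct scopes $S=(s_1,\dots,s_k)\in[n]^k$ and $\eta_S\in\{\pm1\}$; $\mathrm{sat}(x)$ is the fraction of the $m\ge 1$ constraints satisfied by $x\in\{\pm1\}^n$. Random $k$-XOR with probability $p\in[0,1]$: each of the $n^k$ tuples $S$ is included independently with probability $p$, and the $\eta_S$ of the included tuples are independent uniform signs. Let $T_S=\eta_S$ if $S$ is the scope of a constraint and $T_S=0$ otherwise; let $M_{U,V}=T_{(U,V)}$ for $U,V\in[n]^{k/2}$, and $\mathbf S=\frac12(M+M^\top)$. For $d\ge1$ and $I=(U_1,\dots,U_d)$, $J=(V_1,\dots,V_d)\in[n]^{kd/2}$ put $\mathbf S^{(d)}_{I,J}=\prod_{s=1}^d \mathbf S_{U_s,V_s}$ and $$R_{I,J}=\frac1{((kd/2)!)^2}\sum_{\pi,\sigma}\mathbf S^{(d)}_{\pi(I),\sigma(J)},$$ where $\pi,\sigma$ run over the permutations of the $kd/2$ positions. Let $D$ be the diagonal matrix with $D_{I,I}=\sqrt{\prod_{i=1}^n\alpha_i(I)!}$,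 where $\alpha_i(I)$ is the number of occurrences of $i$ in $I$, and let $\widetilde R=D^{-1}RD^{-1}$. Algorithm 1 with parameter $d$ outputs $$\widehat{\mathrm{sat}}=\frac12+\frac1{2m}\,\|\widetilde R\|^{1/d}\left(\frac{(kd/2+n-1)!}{(n-1)!}\right)^{1/d},$$ where $\|\cdot\|$ is the spectral norm. **Theorem.** Let $k\ge2$ be even. 1. For all integers $1\le d\le n$, every $k$-XOR instance $\Phi$ on $n$ variables with at least one constraint and every $x\in\{\pm1\}^n$: $\left|\mathrm{sat}(x)-\frac12\right|\le\widehat{\mathrm{sat}}-\frac12$. 2. There are absolute constants $c,C>0$ (independent of $k,n,d,p$) such that for all even $k\geq 2$, all $1\le d\le n$ and all $p\in[0,1]$ with $p\,d^{k/2-1}n^{k/2}>1$, for random $k$-XOR with probability $p$, with probability at least $1-C/n$ the instance is nonempty and $$\widehat{\mathrm{sat}}-\frac12\le c\cdot\frac{\log n}{\sqrt{d^{k/2-1}n^{k/2}p}}\cdot\frac{e^{3k/4}(k/2+1)^{k/2}}{(k/2)^{k/4}}.$$ 3. Let $k$ be fixed and let $d=d(n)\in\{1,\dots,n\}$ and $p=p(n)\in[0,1]$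 satisfy $n^{k-1}p=\omega\big((n/d)^{k/2-1}\log^2n\big)$ as $n\to\infty$. Then the density $n^{k-1}p$ tends to infinity and Algorithm 1 with parameter $d$ strongly refutes random $k$-XOR at this density, that is, $\mathrm{sat}(x)\le\widehat{\mathrm{sat}}$ for every nonempty instance and every $x$, and $\widehat{\mathrm{sat}}=\frac12+o(1)$ with probability tending to $1$. Moreover there is a sequence $\varepsilon_n\to0$ such that, with probability tending to $1$, the instance is nonempty and $|\mathrm{sat}(x)-\frac12|\le\widehat{\mathrm{sat}}-\frac12\le\varepsilon_n$ for all $x\in\{\pm1\}^n$. -/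

import Mathlib

open scoped Nat Matrix
open MeasureTheory Filter Topology Asymptotics

noncomputable section

namespace KXOR

/-- A `k`-XOR instance on the variables `x_0, …, x_{n-1}`: a set of constraints on distinct scopes
`S ∈ [n]^k`.  `Φ S = some η` means that the constraint `∏ i, x (S i) = η` is present, and
`Φ S = none` that there is no constraint with scope `S`. -/
abbrev Instance (k n : ℕ) : Type := (Fin k → Fin n) → Option ℤˣ

/-- The number `m` of constraints. -/
def numConstraints {k n : ℕ} (Φ : Instance k n) : ℕ :=
  (Finset.univ.filter fun S => Φ S ≠ none).card

/-- The fraction of the constraints of `Φ` that the assignment `x ∈ {±1}^n` satisfies. -/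
def sat {k n : ℕ} (Φ : Instance k n) (x : Fin n → ℤˣ) : ℝ :=
  ((Finset.univ.filter fun S => Φ S = some (∏ i, x (S i))).card : ℝ) / (numConstraints Φ : ℝ)

/-! ### The random instance -/

instance : MeasurableSpace (Option ℤˣ) := ⊤

/-- The law of one coordinate of the random instance: with probability `p` the tuple is sampled,
and then its right-hand side is a Rademacher sign. -/
def constraintLaw (p : ℝ) : Measure (Option ℤˣ) :=
  ENNReal.ofReal (1 - p) • Measure.dirac none
    + ENNReal.ofReal (p / 2) • Measure.dirac (some 1)
    + ENNReal.ofReal (p / 2) • Measure.dirac (some (-1))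

/-- Random `k`-XOR with probability `p`: all `n ^ k` coordinates are independent. -/
def randomXOR (k n : ℕ) (p : ℝ) : Measure (Instance k n) :=
  Measure.pi fun _ => constraintLaw p

/-! ### The matrices -/

/-- The constraints tensor: `η_S` on the scopes of constraints and `0` elsewhere. -/
def constraintsTensor {k n : ℕ} (Φ : Instance k n) (S : Fin k → Fin n) : ℝ :=
  match Φ S with
  | none => 0
  | some η => ((η : ℤ) : ℝ)

/-- The concatenation of two `k/2`-tuples, as a `k`-tuple. -/
def joinTuple {k n : ℕ} (hk : Even k) (U V : Fin (k / 2) → Fin n) : Fin k → Fin n :=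
  fun i => Fin.append U V (Fin.cast (by obtain ⟨r, rfl⟩ := hk; omega) i)

/-- The natural `n^{k/2} × n^{k/2}` flattening of the constraints tensor. -/
def flattening {k n : ℕ} (hk : Even k) (Φ : Instance k n) :
    Matrix (Fin (k / 2) → Fin n) (Fin (k / 2) → Fin n) ℝ :=
  Matrix.of fun U V => constraintsTensor Φ (joinTuple hk U V)

/-- The symmetric matrix representation `(M + Mᵀ) / 2`. -/
def symmMatrix {k n : ℕ} (hk : Even k) (Φ : Instance k n) :
    Matrix (Fin (k / 2) → Fin n) (Fin (k / 2) → Fin n) ℝ :=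
  (1 / 2 : ℝ) • (flattening hk Φ + (flattening hk Φ)ᵀ)

/-- The `kd/2` positions of a `kd/2`-tuple, arranged as `d` consecutive blocks of length `k/2`. -/
abbrev Pos (k d : ℕ) : Type := Fin d × Fin (k / 2)

/-- The `kd/2`-tuples with entries in `[n]`. -/
abbrev Index (k d n : ℕ) : Type := Pos k d → Fin n

/-- The `s`-th block of length `k/2` of a `kd/2`-tuple. -/
def block {k d n : ℕ} (I : Index k d n) (s : Fin d) : Fin (k / 2) → Fin n := fun t => I (s, t)

/-- The `d`-th Kronecker power of `symmMatrix`. -/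
def kroneckerPower {k n : ℕ} (hk : Even k) (d : ℕ) (Φ : Instance k n) :
    Matrix (Index k d n) (Index k d n) ℝ :=
  Matrix.of fun I J => ∏ s : Fin d, symmMatrix hk Φ (block I s) (block J s)

/-- The degree-`d` symmetric matrix representation: the average of the Kronecker power over all
rearrangements of the row index and of the column index. -/
def higherMatrix {k n : ℕ} (hk : Even k) (d : ℕ) (Φ : Instance k n) :
    Matrix (Index k d n) (Index k d n) ℝ :=
  Matrix.of fun I J =>
    1 / (Fintype.card (Equiv.Perm (Pos k d)) : ℝ) ^ 2 *
      ∑ π : Equiv.Perm (Pos k d), ∑ σ : Equiv.Perm (Pos k d),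
        kroneckerPower hk d Φ (I ∘ π) (J ∘ σ)

/-- `α_1! ⋯ α_n!`, where `α_i` is the number of times that `i` occurs in the tuple `I`. -/
def histFactorial {k d n : ℕ} (I : Index k d n) : ℕ :=
  ∏ i : Fin n, ((Finset.univ.filter fun a => I a = i).card)!

/-- The diagonal matrix with entries `√(α_1! ⋯ α_n!)`. -/
def histMatrix (k d n : ℕ) : Matrix (Index k d n) (Index k d n) ℝ :=
  Matrix.diagonal fun I => √(histFactorial I : ℝ)

/-- The re-scaled matrix representation `D⁻¹ R D⁻¹`. -/
def rescaledMatrix {k n : ℕ} (hk : Even k) (d : ℕ) (Φ : Instance k n) :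
    Matrix (Index k d n) (Index k d n) ℝ :=
  (histMatrix k d n)⁻¹ * higherMatrix hk d Φ * (histMatrix k d n)⁻¹

/-- The spectral norm of a square real matrix (the operator norm for the Euclidean norm). -/
def specNorm {ι : Type} [Fintype ι] [DecidableEq ι] (A : Matrix ι ι ℝ) : ℝ :=
  ‖Matrix.toEuclideanCLM (n := ι) (𝕜 := ℝ) A‖

/-- The output of the refutation algorithm with parameter `d`. -/
def hsat {k n : ℕ} (hk : Even k) (d : ℕ) (Φ : Instance k n) : ℝ :=
  1 / 2 + 1 / (2 * (numConstraints Φ : ℝ)) *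
    specNorm (rescaledMatrix hk d Φ) ^ (1 / (d : ℝ)) *
    (((k * d / 2 + n - 1)! : ℝ) / ((n - 1)! : ℝ)) ^ (1 / (d : ℝ))

/-- The algorithm `alg` (one function for each number `n` of variables) strongly refutes random
`k`-XOR with probability `p n`, that is, at density `n ^ (k - 1) * p n`, which has to tend to
infinity.  The fraction of satisfied constraints is meaningful for nonempty instances only; in the
second part the instance is nonempty with high probability. -/
def StronglyRefutes (k : ℕ) (alg : ∀ n, Instance k n → ℝ) (p : ℕ → ℝ) : Prop :=
  Tendsto (fun n : ℕ => (n : ℝ) ^ (k - 1) * p n) atTop atTop ∧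
  (∀ (n : ℕ) (Φ : Instance k n), 0 < numConstraints Φ →
    ∀ x : Fin n → ℤˣ, sat Φ x ≤ alg n Φ) ∧
  ∃ ε : ℕ → ℝ, Tendsto ε atTop (𝓝 0) ∧
    Tendsto (fun n : ℕ => (randomXOR k n (p n)).real
      {Φ | 0 < numConstraints Φ ∧ |alg n Φ - 1 / 2| ≤ ε n}) atTop (𝓝 1)

end KXOR

end

noncomputable section

namespace KXOR

/-! ### The spectral norm -/

section SpecNorm

variable {ι : Type} [Fintype ι] [DecidableEq ι]

/-! Write h = k/2 and N = dh, and let P be the symmetrizer, so that R = P S^{(d)} Pᵀ.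

Validity is one quadratic form. The tensor power y of an assignment is fixed by Pᵀ, so yᵀRy = (∑ T_S
x^S)^d = (2m(sat(x) − 1/2))^d (`dotProduct_higherMatrix`, `sum_constraintsTensor_mul`). Testing the
rescaled matrix on Dy gives the same number, and |Dy|² = ∑_I ∏ α_i(I)! is the rising factorial
n(n+1)⋯(n+N−1) (`sum_histFactorial`). Taking d-th roots gives `abs_sat_sub_le`.

The random bound is a trace moment estimate. By cyclicity the trace of a power of the rescaled
matrix is that of (G S^{(d)})^t with G = PᵀD⁻²P. The rescaling is exactly what makes every entry of
G at most 1/N! (`symmetrizerGram_le`); moreover G links only tuples with common letters. Expanding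
in the entries of T turns the trace into a sum over walks, each step using d scopes. In expectation
a walk survives only if every scope occurs an even number of times, hence with at most M = td/2
distinct scopes, and then contributes a power p^r for r distinct scopes
(`integral_prod_constraintsTensor_le`).

The walks are not enumerated by shape. Instead p^r is dominated by a multiple of the potential
`setWeight`, (M/B)^r cut off at r = M, where B bounds the number of scopes available at a step. A
repeated scope has at most M choices and a new one at most B choices at the price M/B, so each scope
costs a factor at most 2M and each step at most (2M)^d/N! (`sum_setWeight_image_le`,
`sum_stepMatrix_le`). Induction over the walk (`sum_walks_le`) then bounds the moment, t of order
log n makes the dimension factor harmless, and Markov's inequality finishes. Chebyshev's inequality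
bounds the number of constraints from below. -/

theorem specNorm_nonneg (A : Matrix ι ι ℝ) : 0 ≤ specNorm A := norm_nonneg _

theorem specNorm_sq_le_sum_sq (A : Matrix ι ι ℝ) :
    specNorm A ^ 2 ≤ ∑ i, ∑ j, A i j ^ 2 := by
  have hs : 0 ≤ ∑ i, ∑ j, A i j ^ 2 := by positivity
  have h : specNorm A ≤ √(∑ i, ∑ j, A i j ^ 2) := by
    refine ContinuousLinearMap.opNorm_le_bound _ (Real.sqrt_nonneg _) fun v => ?_
    rw [EuclideanSpace.norm_eq, EuclideanSpace.norm_eq, ← Real.sqrt_mul hs]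
    refine Real.sqrt_le_sqrt ?_
    simp only [Real.norm_eq_abs, sq_abs]
    rw [Finset.sum_mul]
    refine Finset.sum_le_sum fun i _ => ?_
    have : (Matrix.toEuclideanCLM (n := ι) (𝕜 := ℝ) A v) i = ∑ j, A i j * v j := by
      rw [Matrix.ofLp_toEuclideanCLM]
      simp [Matrix.mulVec, dotProduct]
    rw [this]
    exact Finset.sum_mul_sq_le_sq_mul_sq _ _ _
  calc specNorm A ^ 2 ≤ √(∑ i, ∑ j, A i j ^ 2) ^ 2 :=
        pow_le_pow_left₀ (specNorm_nonneg A) h 2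
    _ = _ := Real.sq_sqrt hs

theorem abs_dotProduct_mulVec_le (A : Matrix ι ι ℝ) (y : ι → ℝ) :
    |y ⬝ᵥ A *ᵥ y| ≤ specNorm A * ∑ i, y i ^ 2 := by
  have h1 : y ⬝ᵥ A *ᵥ y = inner ℝ (WithLp.toLp 2 y)
      (Matrix.toEuclideanCLM (n := ι) (𝕜 := ℝ) A (WithLp.toLp 2 y)) := by
    rw [Matrix.toEuclideanCLM_toLp, EuclideanSpace.inner_toLp_toLp]
    simp [dotProduct_comm]
  have h2 : ‖WithLp.toLp 2 y‖ ^ 2 = ∑ i, y i ^ 2 := by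
    simp [EuclideanSpace.norm_sq_eq]
  rw [h1, ← h2, sq, ← mul_assoc]
  refine (abs_real_inner_le_norm _ _).trans ?_
  rw [mul_comm]
  exact mul_le_mul_of_nonneg_right (ContinuousLinearMap.le_opNorm _ _) (norm_nonneg _)

/-- For self-adjoint operators the norm commutes with repeated squaring, and the norm of A^(2^j) is
at most its Frobenius norm, whose square is the trace. No spectral theorem is needed, at the cost of
restricting the moments to powers of two. -/
theorem specNorm_pow_le_trace {A : Matrix ι ι ℝ} (hA : Aᵀ = A) (j : ℕ) :
    specNorm A ^ (2 * 2 ^ j) ≤ (A ^ (2 * 2 ^ j)).trace := by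
  have hsa : IsSelfAdjoint (Matrix.toEuclideanCLM (n := ι) (𝕜 := ℝ) A) := by
    have : IsSelfAdjoint A := by
      rw [IsSelfAdjoint, Matrix.star_eq_conjTranspose, Matrix.conjTranspose_eq_transpose_of_trivial,
        hA]
    exact this.map _
  have h1 : specNorm A ^ (2 ^ j) = specNorm (A ^ (2 ^ j)) := by
    rw [specNorm, specNorm, map_pow, hsa.norm_pow_two_pow]
  have hT : (A ^ (2 ^ j))ᵀ = A ^ (2 ^ j) := by rw [Matrix.transpose_pow, hA]
  rw [mul_comm, pow_mul, h1, pow_mul]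
  refine (specNorm_sq_le_sum_sq _).trans_eq ?_
  rw [sq, Matrix.trace]
  refine Finset.sum_congr rfl fun i _ => ?_
  rw [Matrix.diag_apply, Matrix.mul_apply]
  refine Finset.sum_congr rfl fun k _ => ?_
  rw [sq]
  congr 1
  conv_lhs => rw [← hT, Matrix.transpose_apply]

end SpecNorm

/-- For t = 0 the two traces are the two dimensions, which is why t ≥ 1 is asked. -/
theorem trace_mul_pow {m n R : Type*} [Fintype m] [Fintype n] [DecidableEq m] [DecidableEq n]
    [CommRing R] (A : Matrix m n R) (B : Matrix n m R) (t : ℕ) (ht : 1 ≤ t) :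
    ((A * B) ^ t).trace = ((B * A) ^ t).trace := by
  obtain ⟨s, rfl⟩ := Nat.exists_eq_succ_of_ne_zero (by omega : t ≠ 0)
  have h : ∀ s : ℕ, (A * B) ^ (s + 1) = A * (B * A) ^ s * B := by
    intro s
    induction s with
    | zero => simp
    | succ s ih =>
      rw [pow_succ, ih, pow_succ (B * A)]
      simp only [Matrix.mul_assoc]
  rw [Nat.succ_eq_add_one, h, Matrix.mul_assoc, Matrix.trace_mul_comm, pow_succ, Matrix.mul_assoc]

/-! ### Expansion of powers of matrices -/

section Walks

variable {V G : Type*} [Fintype V] [DecidableEq V]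

theorem sum_smul_pow [Fintype G] (C : G → Matrix V V ℝ) (τ : G → ℝ) (t : ℕ) :
    (∑ g, τ g • C g) ^ t =
      ∑ f : Fin t → G, (∏ i, τ (f i)) • (List.ofFn fun i => C (f i)).prod := by
  induction t with
  | zero => simp
  | succ t ih =>
    rw [pow_succ', ih, ← (Fin.consEquiv fun _ : Fin (t + 1) => G).sum_comp,
      Fintype.sum_prod_type, Finset.sum_mul]
    refine Finset.sum_congr rfl fun g _ => ?_
    rw [Finset.mul_sum]
    refine Finset.sum_congr rfl fun f _ => ?_
    simp [Fin.consEquiv, Fin.prod_univ_succ, List.ofFn_succ, smul_smul, mul_comm]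

theorem list_prod_nonneg {C : G → Matrix V V ℝ} (hC : ∀ g i j, 0 ≤ C g i j) {t : ℕ}
    (f : Fin t → G) (i j : V) : 0 ≤ (List.ofFn fun s => C (f s)).prod i j := by
  induction t generalizing i with
  | zero =>
    rw [List.ofFn_zero, List.prod_nil, Matrix.one_apply]
    split_ifs <;> simp
  | succ t ih =>
    rw [List.ofFn_succ, List.prod_cons, Matrix.mul_apply]
    exact Finset.sum_nonneg fun k _ => mul_nonneg (hC _ _ _) (ih (fun s => f s.succ) k)

/-- A supermartingale-type induction: `A` is the set already visited and `w` a potential which one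
step multiplies by at most `θ` on average, uniformly in the current vertex. Peeling off the first
step keeps the induction hypothesis available for the enlarged set. -/
theorem sum_walks_le [Fintype G] {α : Type*} [DecidableEq α] {C : G → Matrix V V ℝ}
    (hC : ∀ g i j, 0 ≤ C g i j) (im : G → Finset α) (w : Finset α → ℝ)
    {θ : ℝ} (hθ : 0 ≤ θ) (h : ∀ A i, ∑ g, (∑ j, C g i j) * w (A ∪ im g) ≤ θ * w A)
    (t : ℕ) (A : Finset α) (i : V) :
    ∑ f : Fin t → G, (∑ j, (List.ofFn fun s => C (f s)).prod i j) *
      w (A ∪ Finset.univ.biUnion fun s => im (f s)) ≤ θ ^ t * w A := by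
  induction t generalizing A i with
  | zero => simp [Matrix.one_apply]
  | succ t ih =>
    rw [← (Fin.consEquiv fun _ : Fin (t + 1) => G).sum_comp, Fintype.sum_prod_type]
    have hun : ∀ (g : G) (f : Fin t → G),
        (A ∪ Finset.univ.biUnion fun s => im ((Fin.cons g f : Fin (t + 1) → G) s)) =
          (A ∪ im g) ∪ Finset.univ.biUnion fun s => im (f s) := by
      intro g f
      ext a
      simp [Fin.exists_fin_succ]
    calc _ = ∑ g, ∑ k, C g i k * ∑ f : Fin t → G,
          (∑ j, (List.ofFn fun s => C (f s)).prod k j) *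
            w ((A ∪ im g) ∪ Finset.univ.biUnion fun s => im (f s)) := by
          refine Finset.sum_congr rfl fun g _ => ?_
          simp only [Finset.mul_sum]
          rw [Finset.sum_comm]
          refine Finset.sum_congr rfl fun f _ => ?_
          change (∑ j, (List.ofFn fun s => C ((Fin.cons g f : Fin (t + 1) → G) s)).prod i j) *
            w (A ∪ Finset.univ.biUnion fun s => im ((Fin.cons g f : Fin (t + 1) → G) s)) = _
          rw [hun]
          simp only [List.ofFn_succ, List.prod_cons, Matrix.mul_apply, Fin.cons_zero,
            Fin.cons_succ]
          rw [Finset.sum_comm, Finset.sum_mul]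
          refine Finset.sum_congr rfl fun k _ => ?_
          rw [← Finset.mul_sum, mul_assoc]
      _ ≤ ∑ g, ∑ k, C g i k * (θ ^ t * w (A ∪ im g)) :=
          Finset.sum_le_sum fun g _ => Finset.sum_le_sum fun k _ =>
            mul_le_mul_of_nonneg_left (ih _ _) (hC _ _ _)
      _ = θ ^ t * ∑ g, (∑ k, C g i k) * w (A ∪ im g) := by
          rw [Finset.mul_sum]
          refine Finset.sum_congr rfl fun g _ => ?_
          rw [← Finset.sum_mul]
          ring
      _ ≤ θ ^ t * (θ * w A) := mul_le_mul_of_nonneg_left (h _ _) (pow_nonneg hθ t)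
      _ = θ ^ (t + 1) * w A := by ring

end Walks

/-! ### The weight of a set of scopes -/

/-- The weight `(M / B) ^ |A|` of a set `A` with at most `M` elements. -/
def setWeight {α : Type*} (M : ℕ) (B : ℝ) (A : Finset α) : ℝ :=
  if A.card ≤ M then ((M : ℝ) / B) ^ A.card else 0

section Weight

variable {α γ : Type*} {M : ℕ} {B : ℝ}

theorem setWeight_nonneg (hB : 0 < B) (A : Finset α) : 0 ≤ setWeight M B A := by
  unfold setWeight
  split_ifs <;> positivity

theorem setWeight_insert_le [DecidableEq α] (hB : 0 < B) {A : Finset α} {a : α} (ha : a ∉ A) :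
    setWeight M B (insert a A) ≤ (M / B) * setWeight M B A := by
  unfold setWeight
  rw [Finset.card_insert_of_notMem ha]
  split_ifs with h1 h2
  · rw [pow_succ']
  · omega
  · positivity
  · simp

/-- Old and new elements each contribute at most `M` times the weight: at most |A| ≤ M choices fall
in `A` and leave the weight unchanged, while at most `B` choices are new and each costs M/B. If |A|
> M, both sides vanish. -/
theorem sum_setWeight_insert_le [DecidableEq α] (hB : 0 < B) {ψ : γ → α} (hψ : Function.Injective ψ)
    (Q : Finset γ) (hQ : (Q.card : ℝ) ≤ B) (A : Finset α) :
    ∑ q ∈ Q, setWeight M B (insert (ψ q) A) ≤ 2 * M * setWeight M B A := by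
  classical
  have hw := setWeight_nonneg (M := M) hB A
  rw [← Finset.sum_filter_add_sum_filter_not Q (fun q => ψ q ∈ A)]
  have h1 : ∑ q ∈ Q with ψ q ∈ A, setWeight M B (insert (ψ q) A) ≤ M * setWeight M B A := by
    rw [Finset.sum_congr rfl (g := fun _ => setWeight M B A)
      fun q hq => by rw [Finset.insert_eq_of_mem (Finset.mem_filter.1 hq).2]]
    rw [Finset.sum_const, nsmul_eq_mul]
    by_cases hA : A.card ≤ M
    · refine mul_le_mul_of_nonneg_right ?_ hw
      have : (Q.filter fun q => ψ q ∈ A).card ≤ A.card :=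
        Finset.card_le_card_of_injOn ψ (fun q hq => (Finset.mem_filter.1 hq).2) hψ.injOn
      exact_mod_cast this.trans hA
    · simp [setWeight, hA]
  have h2 : ∑ q ∈ Q with ψ q ∉ A, setWeight M B (insert (ψ q) A) ≤ M * setWeight M B A := by
    calc _ ≤ ∑ q ∈ Q with ψ q ∉ A, (M / B) * setWeight M B A :=
          Finset.sum_le_sum fun q hq => setWeight_insert_le hB (Finset.mem_filter.1 hq).2
      _ ≤ B * ((M / B) * setWeight M B A) := by
          rw [Finset.sum_const, nsmul_eq_mul]
          refine mul_le_mul_of_nonneg_right (le_trans ?_ hQ) (by positivity)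
          exact_mod_cast Finset.card_filter_le _ _
      _ = _ := by field_simp
  linarith

theorem sum_setWeight_image_le [DecidableEq α] [Fintype γ] [DecidableEq γ] (hB : 0 < B) {d : ℕ}
    {ψ : Fin d → γ → α} (hψ : ∀ s, Function.Injective (ψ s)) (Q : Finset γ)
    (hQ : (Q.card : ℝ) ≤ B) (A : Finset α) :
    ∑ q : Fin d → γ, (if ∀ s, q s ∈ Q then
        setWeight M B (A ∪ Finset.univ.image fun s => ψ s (q s)) else 0) ≤
      (2 * M) ^ d * setWeight M B A := by
  induction d generalizing A with
  | zero => simp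
  | succ d ih =>
    rw [← (Fin.consEquiv fun _ : Fin (d + 1) => γ).sum_comp, Fintype.sum_prod_type]
    have hun : ∀ (a : γ) (q : Fin d → γ),
        (A ∪ Finset.univ.image fun s => ψ s ((Fin.cons a q : Fin (d + 1) → γ) s)) =
          insert (ψ 0 a) A ∪ Finset.univ.image fun s : Fin d => ψ s.succ (q s) := by
      intro a q
      ext e
      simp only [Finset.mem_union, Finset.mem_image, Finset.mem_univ, true_and,
        Fin.exists_fin_succ, Fin.cons_zero, Fin.cons_succ, Finset.mem_insert]
      constructor
      · rintro (h | h | h) <;> simp [h]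
      · rintro ((h | h) | h) <;> simp [h]
    calc _ = ∑ a, if a ∈ Q then ∑ q : Fin d → γ, (if ∀ s, q s ∈ Q then
          setWeight M B (insert (ψ 0 a) A ∪ Finset.univ.image fun s : Fin d => ψ s.succ (q s))
            else 0) else 0 := by
          refine Finset.sum_congr rfl fun a _ => ?_
          split_ifs with ha
          · refine Finset.sum_congr rfl fun q _ => ?_
            simp only [Fin.consEquiv, Equiv.coe_fn_mk]
            rw [hun]
            simp [Fin.forall_fin_succ, ha]
          · refine Finset.sum_eq_zero fun q _ => ?_
            simp [Fin.consEquiv, Fin.forall_fin_succ, ha]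
      _ ≤ ∑ a, if a ∈ Q then (2 * M) ^ d * setWeight M B (insert (ψ 0 a) A) else 0 := by
          refine Finset.sum_le_sum fun a _ => ?_
          split_ifs
          · exact ih (fun s => hψ s.succ) _
          · exact le_rfl
      _ = (2 * M) ^ d * ∑ a ∈ Q, setWeight M B (insert (ψ 0 a) A) := by
          rw [Finset.sum_ite_mem, Finset.univ_inter, Finset.mul_sum]
      _ ≤ (2 * M) ^ d * (2 * M * setWeight M B A) :=
          mul_le_mul_of_nonneg_left (sum_setWeight_insert_le hB (hψ 0) Q hQ A) (by positivity)
      _ = _ := by ring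

end Weight

/-! ### The symmetrizer -/

/-- The projection onto the symmetric tensors. -/
def symmetrizer (k d n : ℕ) : Matrix (Index k d n) (Index k d n) ℝ :=
  Matrix.of fun I J => (1 / (Fintype.card (Equiv.Perm (Pos k d)) : ℝ)) *
    ∑ π : Equiv.Perm (Pos k d), if I ∘ π = J then 1 else 0

theorem higherMatrix_eq {k n : ℕ} (hk : Even k) (d : ℕ) (Φ : Instance k n) :
    higherMatrix hk d Φ =
      symmetrizer k d n * kroneckerPower hk d Φ * (symmetrizer k d n)ᵀ := by
  ext I J
  simp only [higherMatrix, symmetrizer, Matrix.mul_apply, Matrix.of_apply, Matrix.transpose_apply]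
  generalize (Fintype.card (Equiv.Perm (Pos k d)) : ℝ) = c
  have h1 : ∀ J' : Index k d n, ∑ I', (1 / c * ∑ π : Equiv.Perm (Pos k d),
      if I ∘ π = I' then 1 else 0) * kroneckerPower hk d Φ I' J' =
      1 / c * ∑ π : Equiv.Perm (Pos k d), kroneckerPower hk d Φ (I ∘ π) J' := by
    intro J'
    simp only [mul_assoc, ← Finset.mul_sum, Finset.sum_mul]
    rw [Finset.sum_comm]
    simp
  simp only [h1]
  simp only [Finset.mul_sum, Finset.sum_mul]
  rw [Finset.sum_comm]
  conv_rhs => rw [Finset.sum_comm]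
  rw [Finset.sum_comm]
  conv_rhs => enter [2, σ]; rw [Finset.sum_comm]
  rw [Finset.sum_comm]
  refine Finset.sum_congr rfl fun π _ => Finset.sum_congr rfl fun σ _ => ?_
  simp only [mul_ite, mul_one, mul_zero, Finset.sum_ite_eq, Finset.mem_univ, if_true]
  ring

theorem sum_symmetrizer_left {k d n : ℕ} (J : Index k d n) :
    ∑ L, symmetrizer k d n L J = 1 := by
  have hc : (Fintype.card (Equiv.Perm (Pos k d)) : ℝ) ≠ 0 := by
    exact_mod_cast Fintype.card_ne_zero
  simp only [symmetrizer, Matrix.of_apply]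
  rw [← Finset.mul_sum, Finset.sum_comm]
  have h : ∀ π : Equiv.Perm (Pos k d), ∑ L : Index k d n, (if L ∘ π = J then (1 : ℝ) else 0) = 1 := by
    intro π
    have : ∀ L : Index k d n, L ∘ π = J ↔ L = J ∘ π.symm := by
      intro L
      constructor
      · rintro rfl
        ext; simp
      · rintro rfl
        ext; simp
    simp [this]
  simp only [h]
  rw [Finset.sum_const, Finset.card_univ, nsmul_eq_mul, mul_one, one_div_mul_cancel hc]

theorem symmetrizer_nonneg {k d n : ℕ} (I J : Index k d n) : 0 ≤ symmetrizer k d n I J := by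
  simp only [symmetrizer, Matrix.of_apply]
  refine mul_nonneg (by positivity) (Finset.sum_nonneg fun π _ => ?_)
  split_ifs <;> simp

theorem exists_perm_of_symmetrizer_ne_zero {k d n : ℕ} {I J : Index k d n}
    (h : symmetrizer k d n I J ≠ 0) : ∃ π : Equiv.Perm (Pos k d), I ∘ π = J := by
  by_contra! hne
  exact h (by simp [symmetrizer, hne])

/-! ### Stabilizers of tuples and the diagonal rescaling. -/

theorem card_perm_comp_eq_self {k d n : ℕ} (I : Index k d n) :
    (Finset.univ.filter fun π : Equiv.Perm (Pos k d) => I ∘ π = I).card = histFactorial I := by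
  have := DomMulAct.stabilizer_card (f := I)
  simp only [histFactorial]
  rw [← Fintype.card_subtype, this]
  simp [Fintype.card_subtype]

/-- The permutations taking I to J are either absent or a coset of the stabilizer of I, which has
order ∏ α_i(I)!. -/
theorem symmetrizer_le {k d n : ℕ} (I J : Index k d n) :
    symmetrizer k d n I J ≤
      (1 / (Fintype.card (Equiv.Perm (Pos k d)) : ℝ)) * (histFactorial I : ℝ) := by
  simp only [symmetrizer, Matrix.of_apply]
  refine mul_le_mul_of_nonneg_left ?_ (by positivity)
  rw [Finset.sum_boole]
  norm_cast
  by_cases h : ∃ π₀ : Equiv.Perm (Pos k d), I ∘ π₀ = J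
  · obtain ⟨π₀, rfl⟩ := h
    rw [← card_perm_comp_eq_self]
    refine Finset.card_le_card_of_injOn (fun π => π * π₀⁻¹) (fun π hπ => ?_)
      (mul_left_injective _).injOn
    have hπ := (Finset.mem_filter.1 hπ).2
    refine Finset.mem_filter.2 ⟨Finset.mem_univ _, ?_⟩
    ext a
    have := congrFun hπ (π₀⁻¹ a)
    simp only [Function.comp_apply] at this
    simp only [Function.comp_apply, Equiv.Perm.mul_apply, this]
    rw [← Equiv.Perm.mul_apply, mul_inv_cancel, Equiv.Perm.one_apply]
  · push Not at h
    simp [h]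

theorem histFactorial_pos {k d n : ℕ} (I : Index k d n) : 0 < histFactorial I :=
  Finset.prod_pos fun _ _ => Nat.factorial_pos _

theorem histMatrix_inv (k d n : ℕ) : (histMatrix k d n)⁻¹ =
    Matrix.diagonal fun I : Index k d n => (√(histFactorial I : ℝ))⁻¹ := by
  refine Matrix.inv_eq_left_inv ?_
  rw [histMatrix, Matrix.diagonal_mul_diagonal, ← Matrix.diagonal_one]
  congr 1
  ext I
  have : √(histFactorial I : ℝ) ≠ 0 :=
    (Real.sqrt_pos.2 (by exact_mod_cast histFactorial_pos I)).ne'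
  simp [this]

/-- The weighted Gram matrix of the symmetrizer. -/
def symmetrizerGram (k d n : ℕ) : Matrix (Index k d n) (Index k d n) ℝ :=
  (symmetrizer k d n)ᵀ * (histMatrix k d n)⁻¹ * ((histMatrix k d n)⁻¹ * symmetrizer k d n)

theorem symmetrizerGram_apply {k d n : ℕ} (I J : Index k d n) :
    symmetrizerGram k d n I J =
      ∑ L, symmetrizer k d n L I * (histFactorial L : ℝ)⁻¹ * symmetrizer k d n L J := by
  rw [symmetrizerGram, histMatrix_inv, Matrix.mul_apply]
  simp only [Matrix.mul_diagonal, Matrix.diagonal_mul, Matrix.transpose_apply]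
  refine Finset.sum_congr rfl fun L _ => ?_
  have : (√(histFactorial L : ℝ))⁻¹ * (√(histFactorial L : ℝ))⁻¹ = (histFactorial L : ℝ)⁻¹ := by
    rw [← mul_inv, Real.mul_self_sqrt (by positivity)]
  rw [← this]
  ring

theorem symmetrizerGram_nonneg {k d n : ℕ} (I J : Index k d n) :
    0 ≤ symmetrizerGram k d n I J := by
  rw [symmetrizerGram_apply]
  exact Finset.sum_nonneg fun L _ => mul_nonneg
    (mul_nonneg (symmetrizer_nonneg _ _) (by positivity)) (symmetrizer_nonneg _ _)

/-- The factor 1/∏ α_i(L)! cancels the stabilizer order in the bound for the first symmetrizer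
entry, uniformly in L; the columns of the other symmetrizer sum to one. -/
theorem symmetrizerGram_le {k d n : ℕ} (I J : Index k d n) :
    symmetrizerGram k d n I J ≤ 1 / (Fintype.card (Equiv.Perm (Pos k d)) : ℝ) := by
  rw [symmetrizerGram_apply, ← mul_one (1 / (Fintype.card (Equiv.Perm (Pos k d)) : ℝ))]
  nth_rw 2 [← sum_symmetrizer_left J]
  rw [Finset.mul_sum]
  refine Finset.sum_le_sum fun L _ => mul_le_mul_of_nonneg_right ?_ (symmetrizer_nonneg _ _)
  have : (0 : ℝ) < histFactorial L := by exact_mod_cast histFactorial_pos L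
  rw [← div_eq_mul_inv, div_le_iff₀ this]
  exact symmetrizer_le L I

/-- Both tuples are rearrangements of a common L. This confines the first half of each scope to the
at most kd/2 letters of the current vertex, the source of the saving in d. -/
theorem mem_image_of_symmetrizerGram_ne_zero {k d n : ℕ} {I J : Index k d n}
    (h : symmetrizerGram k d n I J ≠ 0) (a : Pos k d) : J a ∈ Finset.univ.image I := by
  rw [symmetrizerGram_apply] at h
  obtain ⟨L, -, hL⟩ := Finset.exists_ne_zero_of_sum_ne_zero h
  obtain ⟨π, rfl⟩ := exists_perm_of_symmetrizer_ne_zero (left_ne_zero_of_mul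
    (left_ne_zero_of_mul hL))
  obtain ⟨σ, rfl⟩ := exists_perm_of_symmetrizer_ne_zero (right_ne_zero_of_mul hL)
  exact Finset.mem_image.2 ⟨π.symm (σ a), Finset.mem_univ _, by simp⟩

theorem trace_rescaledMatrix_pow {k n : ℕ} (hk : Even k) (d : ℕ) (Φ : Instance k n) {t : ℕ}
    (ht : 1 ≤ t) : (rescaledMatrix hk d Φ ^ t).trace =
      ((symmetrizerGram k d n * kroneckerPower hk d Φ) ^ t).trace := by
  have h1 : rescaledMatrix hk d Φ = ((histMatrix k d n)⁻¹ * symmetrizer k d n *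
      kroneckerPower hk d Φ) * ((symmetrizer k d n)ᵀ * (histMatrix k d n)⁻¹) := by
    rw [rescaledMatrix, higherMatrix_eq]
    simp only [Matrix.mul_assoc]
  rw [h1, trace_mul_pow _ _ t ht, symmetrizerGram]
  simp only [Matrix.mul_assoc]

theorem symmMatrix_comm {k n : ℕ} (hk : Even k) (Φ : Instance k n) (U V : Fin (k / 2) → Fin n) :
    symmMatrix hk Φ U V = symmMatrix hk Φ V U := by
  simp [symmMatrix, add_comm]

theorem rescaledMatrix_transpose {k n : ℕ} (hk : Even k) (d : ℕ) (Φ : Instance k n) :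
    (rescaledMatrix hk d Φ)ᵀ = rescaledMatrix hk d Φ := by
  have h : (kroneckerPower hk d Φ)ᵀ = kroneckerPower hk d Φ := by
    ext I J
    simp only [kroneckerPower, Matrix.transpose_apply, Matrix.of_apply]
    exact Finset.prod_congr rfl fun s _ => symmMatrix_comm hk Φ _ _
  rw [rescaledMatrix, higherMatrix_eq, histMatrix_inv]
  simp only [Matrix.transpose_mul, Matrix.diagonal_transpose, Matrix.transpose_transpose, h,
    Matrix.mul_assoc]

/-! ### Expansion of the Kronecker power in the entries of the tensor -/

/-- The two ways of joining a pair of half-scopes. -/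
def orientedJoin {k n : ℕ} (hk : Even k) (b : Bool)
    (q : (Fin (k / 2) → Fin n) × (Fin (k / 2) → Fin n)) : Fin k → Fin n :=
  if b then joinTuple hk q.1 q.2 else joinTuple hk q.2 q.1

theorem joinTuple_injective {k n : ℕ} (hk : Even k) {U V U' V' : Fin (k / 2) → Fin n}
    (h : joinTuple hk U V = joinTuple hk U' V') : U = U' ∧ V = V' := by
  have hkk : k / 2 + k / 2 = k := by obtain ⟨r, rfl⟩ := hk; omega
  have h' : ∀ i : Fin (k / 2 + k / 2), Fin.append U V i = Fin.append U' V' i := by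
    intro i
    have := congrFun h (Fin.cast hkk i)
    simpa [joinTuple] using this
  constructor
  · ext t
    have := h' (Fin.castAdd _ t)
    simp only [Fin.append_left] at this
    rw [this]
  · ext t
    have := h' (Fin.natAdd _ t)
    simp only [Fin.append_right] at this
    rw [this]

theorem orientedJoin_injective {k n : ℕ} (hk : Even k) (b : Bool) :
    Function.Injective (orientedJoin (n := n) hk b) := by
  rintro ⟨U, V⟩ ⟨U', V'⟩ h
  cases b
  · obtain ⟨h1, h2⟩ := joinTuple_injective hk (by simpa [orientedJoin] using h)
    rw [h1, h2]
  · obtain ⟨h1, h2⟩ := joinTuple_injective hk (by simpa [orientedJoin] using h)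
    rw [h1, h2]

theorem kroneckerPower_apply {k n : ℕ} (hk : Even k) (d : ℕ) (Φ : Instance k n)
    (I J : Index k d n) : kroneckerPower hk d Φ I J =
      ∑ b : Fin d → Bool, (1 / 2 : ℝ) ^ d *
        ∏ s, constraintsTensor Φ (orientedJoin hk (b s) (block I s, block J s)) := by
  have h : ∀ U V, symmMatrix hk Φ U V =
      ∑ b : Bool, (1 / 2 : ℝ) * constraintsTensor Φ (orientedJoin hk b (U, V)) := by
    intro U V
    simp [symmMatrix, flattening, orientedJoin, mul_add]
  simp only [kroneckerPower, Matrix.of_apply, h]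
  rw [Fintype.prod_sum]
  refine Finset.sum_congr rfl fun b _ => ?_
  rw [Finset.prod_mul_distrib]
  simp

/-- The coefficient of `∏ s, T (g s)` in the product of the Gram matrix of the symmetrizer and the
Kronecker power. -/
def stepMatrix {k n : ℕ} (hk : Even k) (d : ℕ) (g : Fin d → Fin k → Fin n) :
    Matrix (Index k d n) (Index k d n) ℝ :=
  Matrix.of fun I J => ∑ I', symmetrizerGram k d n I I' * ∑ b : Fin d → Bool,
    if (fun s => orientedJoin hk (b s) (block I' s, block J s)) = g then (1 / 2 : ℝ) ^ d else 0

theorem stepMatrix_nonneg {k n : ℕ} (hk : Even k) (d : ℕ) (g : Fin d → Fin k → Fin n)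
    (I J : Index k d n) : 0 ≤ stepMatrix hk d g I J := by
  refine Finset.sum_nonneg fun I' _ => mul_nonneg (symmetrizerGram_nonneg _ _)
    (Finset.sum_nonneg fun b _ => ?_)
  split_ifs <;> positivity

theorem gram_mul_kroneckerPower_eq {k n : ℕ} (hk : Even k) (d : ℕ) (Φ : Instance k n) :
    symmetrizerGram k d n * kroneckerPower hk d Φ =
      ∑ g : Fin d → Fin k → Fin n, (∏ s, constraintsTensor Φ (g s)) • stepMatrix hk d g := by
  ext I J
  rw [Matrix.sum_apply, Matrix.mul_apply]
  simp only [Matrix.smul_apply, stepMatrix, Matrix.of_apply, smul_eq_mul]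
  simp only [Finset.mul_sum]
  rw [Finset.sum_comm]
  refine Finset.sum_congr rfl fun I' _ => ?_
  rw [Finset.sum_comm, kroneckerPower_apply, Finset.mul_sum]
  refine Finset.sum_congr rfl fun b _ => ?_
  simp only [mul_ite, mul_zero, Finset.sum_ite_eq, Finset.mem_univ, if_true]
  ring

/-- The one-step hypothesis of `sum_walks_le`. From the vertex I, a step amounts to d pairs of
half-scopes, the first half written in the letters of I and the second free, so each pair has at
most (d(k/2)·n)^(k/2) values. -/
theorem sum_stepMatrix_le {k n : ℕ} (hk : Even k) {d M : ℕ} {B : ℝ} (hB : 0 < B)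
    (hNB : ((d * (k / 2) * n : ℕ) : ℝ) ^ (k / 2) ≤ B) (A : Finset (Fin k → Fin n))
    (I : Index k d n) :
    ∑ g, (∑ J, stepMatrix hk d g I J) * setWeight M B (A ∪ Finset.univ.image g) ≤
      ((2 * M) ^ d / (Fintype.card (Equiv.Perm (Pos k d)) : ℝ)) * setWeight M B A := by
  set P : ℝ := (Fintype.card (Equiv.Perm (Pos k d)) : ℝ) with hP
  have hP0 : 0 ≤ P := by positivity
  set Q : Finset ((Fin (k / 2) → Fin n) × (Fin (k / 2) → Fin n)) :=
    (Fintype.piFinset fun _ => Finset.univ.image I) ×ˢ Finset.univ with hQdef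
  have hQ : (Q.card : ℝ) ≤ B := by
    refine le_trans ?_ hNB
    rw [hQdef, Finset.card_product, Fintype.card_piFinset_const, Finset.card_univ]
    have h1 : (Finset.univ.image I).card ≤ d * (k / 2) := by
      refine Finset.card_image_le.trans ?_
      simp [Pos]
    push_cast
    rw [mul_pow]
    simp only [Fintype.card_pi, Fintype.card_fin, Finset.prod_const, Finset.card_univ]
    push_cast
    have h2 : ((Finset.univ.image I).card : ℝ) ≤ d * (k / 2 : ℕ) := by exact_mod_cast h1
    have h3 := pow_le_pow_left₀ (by positivity) h2 (k / 2)
    exact mul_le_mul_of_nonneg_right h3 (by positivity)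
  let W : Finset (Fin k → Fin n) → ℝ := setWeight M B
  have hW : ∀ A, 0 ≤ W A := setWeight_nonneg hB
  calc _ = ∑ b : Fin d → Bool, ∑ I', ∑ J, symmetrizerGram k d n I I' * ((1 / 2 : ℝ) ^ d *
        W (A ∪ Finset.univ.image fun s => orientedJoin hk (b s) (block I' s, block J s))) := by
        simp only [stepMatrix, Matrix.of_apply, Finset.sum_mul, Finset.mul_sum]
        rw [Finset.sum_comm]
        simp_rw [Finset.sum_comm (s := (Finset.univ : Finset (Fin d → Fin k → Fin n)))]
        rw [Finset.sum_comm]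
        conv_rhs => rw [Finset.sum_comm]
        refine Finset.sum_congr rfl fun I' _ => ?_
        rw [Finset.sum_comm]
        refine Finset.sum_congr rfl fun b _ => Finset.sum_congr rfl fun J _ => ?_
        simp only [mul_ite, mul_zero, ite_mul, zero_mul, Finset.sum_ite_eq, Finset.mem_univ,
          if_true, mul_assoc, W]
    _ ≤ ∑ b : Fin d → Bool, ∑ I' : Index k d n, ∑ J : Index k d n, (1 / P) * ((1 / 2 : ℝ) ^ d *
        if ∀ s, (block I' s, block J s) ∈ Q then
        W (A ∪ Finset.univ.image fun s => orientedJoin hk (b s) (block I' s, block J s))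
          else 0) := by
        refine Finset.sum_le_sum fun b _ => Finset.sum_le_sum fun I' _ =>
          Finset.sum_le_sum fun J _ => ?_
        by_cases h0 : symmetrizerGram k d n I I' = 0
        · rw [h0, zero_mul]
          refine mul_nonneg (by positivity) (mul_nonneg (by positivity) ?_)
          split_ifs
          · exact hW _
          · exact le_rfl
        · rw [if_pos]
          · exact mul_le_mul_of_nonneg_right (symmetrizerGram_le _ _)
              (mul_nonneg (by positivity) (hW _))
          · intro s
            rw [hQdef, Finset.mem_product, Fintype.mem_piFinset]
            exact ⟨fun t => mem_image_of_symmetrizerGram_ne_zero h0 (s, t), Finset.mem_univ _⟩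
    _ = (1 / P) * (1 / 2 : ℝ) ^ d * ∑ b : Fin d → Bool,
        ∑ q : Fin d → (Fin (k / 2) → Fin n) × (Fin (k / 2) → Fin n),
        if ∀ s, q s ∈ Q then
        W (A ∪ Finset.univ.image fun s => orientedJoin hk (b s) (q s)) else 0 := by
        rw [Finset.mul_sum]
        refine Finset.sum_congr rfl fun b _ => ?_
        -- A pair of tuples (I', J) is regrouped into d pairs of blocks, so that the scopes can be
        -- summed one at a time.
        rw [← ((Equiv.arrowProdEquivProdArrow (Fin d) (fun _ => Fin (k / 2) → Fin n)
          (fun _ => Fin (k / 2) → Fin n)).trans (Equiv.prodCongr (Equiv.curry _ _ _).symm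
            (Equiv.curry _ _ _).symm)).symm.sum_comp, Fintype.sum_prod_type, Finset.mul_sum]
        refine Finset.sum_congr rfl fun I' _ => ?_
        rw [Finset.mul_sum]
        refine Finset.sum_congr rfl fun J _ => ?_
        rw [mul_assoc]
        rfl
    _ ≤ (1 / P) * (1 / 2 : ℝ) ^ d * ∑ b : Fin d → Bool, (2 * M) ^ d * W A := by
        refine mul_le_mul_of_nonneg_left (Finset.sum_le_sum fun b _ => ?_) (by positivity)
        exact sum_setWeight_image_le hB (fun s => orientedJoin_injective hk (b s)) Q hQ A
    _ = _ := by
        rw [Finset.sum_const, Finset.card_univ, nsmul_eq_mul]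
        simp only [Fintype.card_pi, Fintype.card_bool, Finset.prod_const, Finset.card_univ,
          Fintype.card_fin, W]
        push_cast
        -- The 2^d orientations cancel the halves from the symmetrization of the flattening.
        have : (1 / 2 : ℝ) ^ d * 2 ^ d = 1 := by rw [← mul_pow]; norm_num
        linear_combination (1 / P) * ((2 * M) ^ d * setWeight M B A) * this

/-! ### Moments of the random instance -/

theorem isProbabilityMeasure_constraintLaw {p : ℝ} (h0 : 0 ≤ p) (h1 : p ≤ 1) :
    IsProbabilityMeasure (constraintLaw p) := by
  constructor
  simp only [constraintLaw, Measure.add_apply, Measure.smul_apply, measure_univ, smul_eq_mul,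
    mul_one]
  rw [← ENNReal.ofReal_add (by linarith) (by linarith), ← ENNReal.ofReal_add (by linarith)
    (by linarith)]
  rw [show 1 - p + p / 2 + p / 2 = 1 by ring, ENNReal.ofReal_one]

theorem integral_constraintLaw {p : ℝ} (h0 : 0 ≤ p) (h1 : p ≤ 1) (f : Option ℤˣ → ℝ) :
    ∫ o, f o ∂constraintLaw p = (1 - p) * f none + p / 2 * f (some 1) + p / 2 * f (some (-1)) := by
  have hi : ∀ (c : ℝ) (a : Option ℤˣ),
      Integrable f (ENNReal.ofReal c • Measure.dirac a) := fun c a =>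
    (integrable_dirac (by simp)).smul_measure ENNReal.ofReal_ne_top
  rw [constraintLaw, integral_add_measure ((hi _ _).add_measure (hi _ _)) (hi _ _),
    integral_add_measure (hi _ _) (hi _ _)]
  simp only [integral_smul_measure, integral_dirac, smul_eq_mul]
  rw [ENNReal.toReal_ofReal (by linarith), ENNReal.toReal_ofReal (by linarith)]

/-- The entry of the constraints tensor at a scope, as a function of the constraint there. -/
def signValue : Option ℤˣ → ℝ
  | none => 0
  | some η => ((η : ℤ) : ℝ)

theorem constraintsTensor_eq {k n : ℕ} (Φ : Instance k n) (S : Fin k → Fin n) :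
    constraintsTensor Φ S = signValue (Φ S) := by
  unfold constraintsTensor signValue
  cases Φ S <;> rfl

theorem integral_signValue_pow {p : ℝ} (h0 : 0 ≤ p) (h1 : p ≤ 1) (m : ℕ) :
    ∫ o, signValue o ^ m ∂constraintLaw p =
      if m = 0 then 1 else if Even m then p else 0 := by
  rw [integral_constraintLaw h0 h1]
  simp only [signValue]
  split_ifs with hm he
  · subst hm
    simp
    ring
  · simp [hm, he.neg_one_pow]
  · simp [hm, (Nat.not_even_iff_odd.1 he).neg_one_pow]

/-- Independence factors the expectation over distinct scopes. An odd multiplicity gives zero by the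
symmetry of the signs; a positive even one gives p. If all multiplicities are even, every scope
present is used at least twice, whence the cardinality condition. -/
theorem integral_prod_constraintsTensor_le {k n : ℕ} {p : ℝ} (h0 : 0 ≤ p) (h1 : p ≤ 1)
    {X : Type*} [Fintype X] (F : X → Fin k → Fin n) :
    ∫ Φ, ∏ x, constraintsTensor Φ (F x) ∂randomXOR k n p ≤
      if 2 * (Finset.univ.image F).card ≤ Fintype.card X then
        p ^ (Finset.univ.image F).card else 0 := by
  have := isProbabilityMeasure_constraintLaw h0 h1
  set m : (Fin k → Fin n) → ℕ := fun S => (Finset.univ.filter fun x => F x = S).card with hm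
  have hprod : ∀ Φ : Instance k n, ∏ x, constraintsTensor Φ (F x) =
      ∏ S, signValue (Φ S) ^ m S := by
    intro Φ
    rw [← Finset.prod_fiberwise (s := Finset.univ) (g := F)]
    refine Finset.prod_congr rfl fun S _ => ?_
    rw [Finset.prod_congr rfl (g := fun _ => signValue (Φ S)), Finset.prod_const]
    intro x hx
    rw [constraintsTensor_eq, (Finset.mem_filter.1 hx).2]
  simp only [hprod]
  rw [randomXOR, integral_fintype_prod_eq_prod (fun S o => signValue o ^ m S)]
  simp only [integral_signValue_pow h0 h1]
  have hmem : ∀ S, m S ≠ 0 ↔ S ∈ Finset.univ.image F := by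
    intro S
    simp [hm, Finset.filter_eq_empty_iff]
  by_cases hodd : ∀ S, Even (m S)
  · have hcard : 2 * (Finset.univ.image F).card ≤ Fintype.card X := by
      rw [← Finset.card_univ, Finset.card_eq_sum_card_image F Finset.univ, mul_comm,
        ← smul_eq_mul]
      refine Finset.card_nsmul_le_sum (Finset.univ.image F) m 2 fun S hS => ?_
      have h2 := (hmem S).2 hS
      obtain ⟨r, hr⟩ := hodd S
      omega
    rw [if_pos hcard]
    have : ∀ S, (if m S = 0 then 1 else if Even (m S) then p else 0) =
        if S ∈ Finset.univ.image F then p else 1 := by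
      intro S
      rw [if_pos (hodd S)]
      by_cases hS : m S = 0
      · rw [if_pos hS, if_neg (fun h => (hmem S).2 h hS)]
      · rw [if_neg hS, if_pos ((hmem S).1 hS)]
    simp only [this]
    rw [Finset.prod_ite_mem, Finset.univ_inter, Finset.prod_const]
  · push Not at hodd
    obtain ⟨S, hS⟩ := hodd
    rw [Finset.prod_eq_zero (Finset.mem_univ S)]
    · split_ifs <;> positivity
    · rw [if_neg (by rintro h; simp [h] at hS), if_neg hS]

instance {k n : ℕ} : MeasurableSingletonClass (Instance k n) :=
  inferInstanceAs (MeasurableSingletonClass ((Fin k → Fin n) → Option ℤˣ))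

theorem isProbabilityMeasure_randomXOR {p : ℝ} (h0 : 0 ≤ p) (h1 : p ≤ 1) (k n : ℕ) :
    IsProbabilityMeasure (randomXOR k n p) := by
  have := isProbabilityMeasure_constraintLaw h0 h1
  unfold randomXOR
  infer_instance

/-- The number `z` is the price of replacing the true weights p^r by the potential, for which the
step estimate is balanced; the power of n counts the starting vertices. -/
theorem integral_trace_pow_le {k n d t M : ℕ} (hk : Even k) {p B z : ℝ} (h0 : 0 ≤ p)
    (h1 : p ≤ 1) (hB : 0 < B) (hNB : ((d * (k / 2) * n : ℕ) : ℝ) ^ (k / 2) ≤ B)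
    (ht : t * d = 2 * M) (hz : ∀ r ≤ M, p ^ r ≤ z * ((M : ℝ) / B) ^ r) :
    ∫ Φ, ((symmetrizerGram k d n * kroneckerPower hk d Φ) ^ t).trace ∂randomXOR k n p ≤
      (n : ℝ) ^ (d * (k / 2)) *
        (z * ((2 * M) ^ d / (Fintype.card (Equiv.Perm (Pos k d)) : ℝ)) ^ t) := by
  have := isProbabilityMeasure_randomXOR h0 h1 k n
  set θ : ℝ := (2 * M) ^ d / (Fintype.card (Equiv.Perm (Pos k d)) : ℝ) with hθ
  have hθ0 : 0 ≤ θ := by positivity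
  have hz0 : 0 ≤ z := by
    have := hz 0 (Nat.zero_le _)
    simp at this
    linarith
  have hcard : (n : ℝ) ^ (d * (k / 2)) = ∑ _I : Index k d n, (1 : ℝ) := by
    simp
  have hC := stepMatrix_nonneg (n := n) hk d
  simp only [gram_mul_kroneckerPower_eq, Matrix.trace, Matrix.diag_apply, sum_smul_pow,
    Matrix.sum_apply, Matrix.smul_apply, smul_eq_mul]
  rw [integral_finsetSum _ fun _ _ => Integrable.of_finite, hcard, Finset.sum_mul]
  refine Finset.sum_le_sum fun I _ => ?_
  rw [integral_finsetSum _ fun _ _ => Integrable.of_finite, one_mul]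
  calc _ ≤ ∑ f : Fin t → Fin d → Fin k → Fin n, z *
        ((∑ J, (List.ofFn fun s => stepMatrix hk d (f s)).prod I J) *
          setWeight M B (∅ ∪ Finset.univ.biUnion fun s => Finset.univ.image (f s))) := by
        refine Finset.sum_le_sum fun f _ => ?_
        rw [integral_mul_const]
        have hf : ∀ Φ : Instance k n, ∏ i, ∏ s, constraintsTensor Φ (f i s) =
            ∏ x : Fin t × Fin d, constraintsTensor Φ (f x.1 x.2) := fun Φ =>
          (Fintype.prod_prod_type' _).symm
        simp only [hf]
        have him : (∅ ∪ Finset.univ.biUnion fun s => Finset.univ.image (f s)) =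
            Finset.univ.image fun x : Fin t × Fin d => f x.1 x.2 := by
          ext e
          simp
        rw [him]
        have hE := integral_prod_constraintsTensor_le h0 h1
          (fun x : Fin t × Fin d => f x.1 x.2)
        have hw : (if 2 * (Finset.univ.image fun x : Fin t × Fin d => f x.1 x.2).card ≤
            Fintype.card (Fin t × Fin d) then
            p ^ (Finset.univ.image fun x : Fin t × Fin d => f x.1 x.2).card else 0) ≤
            z * setWeight M B (Finset.univ.image fun x : Fin t × Fin d => f x.1 x.2) := by
          rw [Fintype.card_prod, Fintype.card_fin, Fintype.card_fin, ht]
          unfold setWeight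
          split_ifs with h1 h2 h2
          · exact hz _ h2
          · omega
          · omega
          · simp
        have hnn := list_prod_nonneg hC f I
        -- The condition that the walk closes up is dropped: a diagonal entry is at most its row
        -- sum, by nonnegativity.
        calc _ ≤ (z * setWeight M B (Finset.univ.image fun x : Fin t × Fin d => f x.1 x.2)) *
              (List.ofFn fun s => stepMatrix hk d (f s)).prod I I :=
              mul_le_mul_of_nonneg_right (hE.trans hw) (hnn I)
          _ ≤ (z * setWeight M B (Finset.univ.image fun x : Fin t × Fin d => f x.1 x.2)) *
              ∑ J, (List.ofFn fun s => stepMatrix hk d (f s)).prod I J :=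
              mul_le_mul_of_nonneg_left
                (Finset.single_le_sum (fun J _ => hnn J) (Finset.mem_univ I))
                (mul_nonneg hz0 (setWeight_nonneg hB _))
          _ = _ := by ring
    _ ≤ z * (θ ^ t * setWeight M B (∅ : Finset (Fin k → Fin n))) := by
        rw [← Finset.mul_sum]
        refine mul_le_mul_of_nonneg_left ?_ hz0
        exact sum_walks_le hC (fun g => Finset.univ.image g) (setWeight M B) hθ0
          (fun A I => sum_stepMatrix_le hk hB hNB A I) t ∅ I
    _ = z * θ ^ t := by simp [setWeight]

/-! ### The number of constraints -/

/-- Chebyshev's inequality at half the mean: the indicators are independent and satisfy X² = X, so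
the variance is at most the mean. -/
theorem measureReal_numConstraints_lt_le {k n : ℕ} {p : ℝ} (h0 : 0 ≤ p) (h1 : p ≤ 1)
    (hp : 0 < (n : ℝ) ^ k * p) :
    (randomXOR k n p).real {Φ | (numConstraints Φ : ℝ) < (n : ℝ) ^ k * p / 2} ≤
      4 / ((n : ℝ) ^ k * p) := by
  have := isProbabilityMeasure_constraintLaw h0 h1
  have := isProbabilityMeasure_randomXOR h0 h1 k n
  let X : Option ℤˣ → ℝ := fun o => if o = none then 0 else 1
  have hnum : ∀ Φ : Instance k n, (numConstraints Φ : ℝ) = ∑ S, X (Φ S) := by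
    intro Φ
    simp [numConstraints, X, Finset.sum_ite, Finset.filter_not]
  have hcard : (Fintype.card (Fin k → Fin n) : ℝ) = (n : ℝ) ^ k := by simp
  have hXi : ∫ o, X o ∂constraintLaw p = p := by
    rw [integral_constraintLaw h0 h1]
    simp [X]
  have hE : ∫ Φ, (numConstraints Φ : ℝ) ∂randomXOR k n p = (n : ℝ) ^ k * p := by
    simp only [hnum]
    rw [integral_finsetSum _ fun _ _ => Integrable.of_finite]
    have : ∀ S : Fin k → Fin n, ∫ Φ : Instance k n, X (Φ S) ∂randomXOR k n p = p := by
      intro S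
      rw [randomXOR, integral_comp_eval (μ := fun _ : Fin k → Fin n => constraintLaw p)
        (Integrable.of_finite (f := X)).aestronglyMeasurable, hXi]
    simp only [this]
    rw [Finset.sum_const, Finset.card_univ, nsmul_eq_mul, hcard]
  have hmeas : ∀ {Ω : Type} [MeasurableSpace Ω] [Finite Ω] [MeasurableSingletonClass Ω]
      (μ : Measure Ω) [IsFiniteMeasure μ] (f : Ω → ℝ), MemLp f 2 μ := by
    intro Ω _ _ _ μ _ f
    exact MemLp.of_discrete
  have hV : ProbabilityTheory.variance (fun Φ : Instance k n => (numConstraints Φ : ℝ))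
      (randomXOR k n p) ≤ (n : ℝ) ^ k * p := by
    have h2 : (fun Φ : Instance k n => (numConstraints Φ : ℝ)) =
        ∑ S : Fin k → Fin n, fun Φ : Instance k n => X (Φ S) := by
      ext Φ
      rw [hnum, Finset.sum_apply]
    rw [h2, randomXOR, ProbabilityTheory.variance_sum_pi (X := fun _ => X)
      (μ := fun _ : Fin k → Fin n => constraintLaw p) fun S => hmeas _ _]
    rw [← hcard, ← nsmul_eq_mul, ← Finset.card_univ]
    refine Finset.sum_le_card_nsmul _ _ _ fun S _ => ?_
    refine (ProbabilityTheory.variance_le_expectation_sq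
      (Integrable.of_finite (f := X)).aestronglyMeasurable).trans_eq ?_
    refine Eq.trans ?_ hXi
    refine integral_congr_ae (Eventually.of_forall fun o => ?_)
    simp [X]
  set μ0 := (n : ℝ) ^ k * p with hμ0
  have hch := ProbabilityTheory.meas_ge_le_variance_div_sq (μ := randomXOR k n p)
    (hmeas _ (fun Φ : Instance k n => (numConstraints Φ : ℝ))) (c := μ0 / 2) (by positivity)
  rw [hE] at hch
  have h3 : (randomXOR k n p).real {Φ | (numConstraints Φ : ℝ) < μ0 / 2} ≤
      ProbabilityTheory.variance (fun Φ : Instance k n => (numConstraints Φ : ℝ))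
        (randomXOR k n p) / (μ0 / 2) ^ 2 := by
    refine ENNReal.toReal_le_of_le_ofReal
      (div_nonneg (ProbabilityTheory.variance_nonneg _ _) (by positivity)) (le_trans ?_ hch)
    refine measure_mono fun Φ hΦ => ?_
    simp only [Set.mem_ofPred_eq] at hΦ ⊢
    rw [abs_of_nonpos] <;> linarith
  refine h3.trans ((div_le_div_of_nonneg_right hV (by positivity)).trans_eq ?_)
  field_simp
  norm_num

/-! ### Validity of the certificate -/

/-- Prepending the letter v multiplies the product by α_v + 1, and summing this over v gives N + n,
the recursion of the rising factorial. -/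
theorem sum_prod_factorial_card_fin (n N : ℕ) :
    ∑ I : Fin N → Fin n, ∏ i : Fin n, ((Finset.univ.filter fun a => I a = i).card)! =
      n.ascFactorial N := by
  induction N with
  | zero => simp
  | succ N ih =>
    rw [← (Fin.consEquiv fun _ : Fin (N + 1) => Fin n).sum_comp, Fintype.sum_prod_type,
      Finset.sum_comm, Nat.ascFactorial_succ, ← ih, Finset.mul_sum]
    refine Finset.sum_congr rfl fun I _ => ?_
    have hcard : ∀ v i : Fin n, (Finset.univ.filter fun a =>
        (Fin.consEquiv fun _ : Fin (N + 1) => Fin n) (v, I) a = i).card =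
          (Finset.univ.filter fun a => I a = i).card + if v = i then 1 else 0 := by
      intro v i
      rw [Fin.card_filter_univ_succ]
      simp only [Fin.consEquiv, Equiv.coe_fn_mk, Fin.cons_zero, Fin.cons_succ]
      split_ifs <;> rfl
    have hfac : ∀ v i : Fin n, ((Finset.univ.filter fun a =>
        (Fin.consEquiv fun _ : Fin (N + 1) => Fin n) (v, I) a = i).card)! =
          (if i = v then (Finset.univ.filter fun a => I a = v).card + 1 else 1) *
            ((Finset.univ.filter fun a => I a = i).card)! := by
      intro v i
      rw [hcard]
      by_cases h : i = v
      · subst h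
        simp [Nat.factorial_succ]
      · simp [h, Ne.symm h]
    simp only [hfac]
    simp only [Finset.prod_mul_distrib, Finset.prod_ite_eq', Finset.mem_univ, if_true]
    rw [← Finset.sum_mul, Finset.sum_add_distrib,
      ← Finset.card_eq_sum_card_fiberwise (f := I) (t := Finset.univ) (by simp)]
    simp [add_comm]

theorem sum_histFactorial (k d n : ℕ) :
    ∑ I : Index k d n, histFactorial I = n.ascFactorial (d * (k / 2)) := by
  rw [← sum_prod_factorial_card_fin,
    ← (Equiv.arrowCongr (finProdFinEquiv (m := d) (n := k / 2)) (Equiv.refl (Fin n))).sum_comp]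
  refine Finset.sum_congr rfl fun I _ => ?_
  unfold histFactorial
  refine Finset.prod_congr rfl fun i _ => ?_
  congr 1
  refine Finset.card_equiv finProdFinEquiv fun a => ?_
  simp only [Finset.mem_filter, Finset.mem_univ, true_and, Equiv.arrowCongr_apply,
    Function.comp_apply, Equiv.symm_apply_apply, Equiv.refl_apply]

/-- The tensor power of an assignment. -/
def assignmentPower {k d n : ℕ} (x : Fin n → ℤˣ) (I : Index k d n) : ℝ :=
  ∏ a, ((x (I a) : ℤ) : ℝ)

theorem unit_sq (u : ℤˣ) : ((u : ℤ) : ℝ) ^ 2 = 1 := by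
  rcases Int.units_eq_one_or u with rfl | rfl <;> simp

theorem assignmentPower_sq {k d n : ℕ} (x : Fin n → ℤˣ) (I : Index k d n) :
    assignmentPower x I ^ 2 = 1 := by
  rw [assignmentPower, ← Finset.prod_pow]
  simp only [unit_sq, Finset.prod_const_one]

theorem assignmentPower_comp {k d n : ℕ} (x : Fin n → ℤˣ) (I : Index k d n)
    (π : Equiv.Perm (Pos k d)) : assignmentPower x (I ∘ π) = assignmentPower x I :=
  Equiv.prod_comp π fun a => ((x (I a) : ℤ) : ℝ)

theorem symmetrizer_transpose_mulVec {k d n : ℕ} (x : Fin n → ℤˣ) :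
    (symmetrizer k d n)ᵀ *ᵥ assignmentPower x = assignmentPower x := by
  ext J
  rw [Matrix.mulVec, dotProduct]
  calc _ = ∑ I, symmetrizer k d n I J * assignmentPower x J := by
        refine Finset.sum_congr rfl fun I _ => ?_
        rw [Matrix.transpose_apply]
        by_cases h : symmetrizer k d n I J = 0
        · simp [h]
        · obtain ⟨π, rfl⟩ := exists_perm_of_symmetrizer_ne_zero h
          rw [assignmentPower_comp]
    _ = _ := by rw [← Finset.sum_mul, sum_symmetrizer_left, one_mul]

/-- A matrix and its transpose have the same quadratic form, so the symmetrization is invisible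
here. -/
theorem sum_flattening {k n : ℕ} (hk : Even k) (Φ : Instance k n) (x : Fin n → ℤˣ) :
    ∑ U : Fin (k / 2) → Fin n, ∑ V : Fin (k / 2) → Fin n,
      (∏ t, ((x (U t) : ℤ) : ℝ)) * symmMatrix hk Φ U V * ∏ t, ((x (V t) : ℤ) : ℝ) =
    ∑ S, constraintsTensor Φ S * ∏ i, ((x (S i) : ℤ) : ℝ) := by
  have hkk : k / 2 + k / 2 = k := by obtain ⟨r, rfl⟩ := hk; omega
  set y : (Fin (k / 2) → Fin n) → ℝ := fun U => ∏ t, ((x (U t) : ℤ) : ℝ) with hy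
  have h1 : ∑ S, constraintsTensor Φ S * ∏ i, ((x (S i) : ℤ) : ℝ) =
      ∑ U, ∑ V, y U * flattening hk Φ U V * y V := by
    rw [← Fintype.sum_prod_type' (f := fun U V => y U * flattening hk Φ U V * y V)]
    symm
    refine Fintype.sum_equiv ((Fin.appendEquiv _ _).trans
      (Equiv.arrowCongr (finCongr hkk) (Equiv.refl _))) _ _ fun q => ?_
    obtain ⟨U, V⟩ := q
    have hS : ((Fin.appendEquiv _ _).trans
      (Equiv.arrowCongr (finCongr hkk) (Equiv.refl (Fin n)))) (U, V) = joinTuple hk U V := by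
      ext i
      simp [joinTuple, Fin.appendEquiv]
    rw [hS]
    have hp : ∏ i, ((x (joinTuple hk U V i) : ℤ) : ℝ) = y U * y V := by
      rw [← (finCongr hkk).prod_comp, Fin.prod_univ_add]
      simp [joinTuple, hy, -Fin.natAdd_eq_addNat]
    rw [hp, flattening, Matrix.of_apply]
    ring
  rw [h1]
  have h2 : ∑ U, ∑ V, y U * flattening hk Φ V U * y V =
      ∑ U, ∑ V, y U * flattening hk Φ U V * y V := by
    rw [Finset.sum_comm]
    exact Finset.sum_congr rfl fun U _ => Finset.sum_congr rfl fun V _ => by ring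
  have h3 : ∀ U V, y U * symmMatrix hk Φ U V * y V =
      1 / 2 * (y U * flattening hk Φ U V * y V) + 1 / 2 * (y U * flattening hk Φ V U * y V) := by
    intro U V
    have : symmMatrix hk Φ U V = 1 / 2 * (flattening hk Φ U V + flattening hk Φ V U) := rfl
    rw [this]
    ring
  refine (Finset.sum_congr rfl fun U _ => Finset.sum_congr rfl fun V _ => h3 U V).trans ?_
  simp only [Finset.sum_add_distrib, ← Finset.mul_sum]
  rw [h2]
  ring

theorem sum_constraintsTensor_mul {k n : ℕ} (Φ : Instance k n) (x : Fin n → ℤˣ)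
    (hm : 0 < numConstraints Φ) :
    ∑ S, constraintsTensor Φ S * ∏ i, ((x (S i) : ℤ) : ℝ) =
      2 * numConstraints Φ * (sat Φ x - 1 / 2) := by
  have hm' : (numConstraints Φ : ℝ) ≠ 0 := by exact_mod_cast hm.ne'
  -- A satisfied constraint counts 1 and a violated one −1, that is, twice the indicator of
  -- satisfaction minus the indicator of presence.
  have h : ∀ S, constraintsTensor Φ S * ∏ i, ((x (S i) : ℤ) : ℝ) =
      2 * (if Φ S = some (∏ i, x (S i)) then 1 else 0) - if Φ S ≠ none then 1 else 0 := by
    intro S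
    have hp : ∏ i, ((x (S i) : ℤ) : ℝ) = (((∏ i, x (S i) : ℤˣ) : ℤ) : ℝ) := by
      push_cast
      rfl
    rw [hp, constraintsTensor_eq]
    generalize ∏ i, x (S i) = u
    rcases hS : Φ S with _ | η
    · simp [signValue]
    · simp only [signValue]
      rcases Int.units_eq_one_or u with rfl | rfl <;>
        rcases Int.units_eq_one_or η with rfl | rfl <;> simp <;> norm_num
  simp only [h]
  rw [Finset.sum_sub_distrib, ← Finset.mul_sum, Finset.sum_boole, Finset.sum_boole, sat]
  rw [show ((Finset.univ.filter fun S => Φ S ≠ none).card : ℝ) = numConstraints Φ from rfl]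
  field_simp

theorem dotProduct_higherMatrix {k n : ℕ} (hk : Even k) (d : ℕ) (Φ : Instance k n)
    (x : Fin n → ℤˣ) :
    assignmentPower x ⬝ᵥ higherMatrix hk d Φ *ᵥ assignmentPower x =
      (∑ S, constraintsTensor Φ S * ∏ i, ((x (S i) : ℤ) : ℝ)) ^ d := by
  rw [higherMatrix_eq, ← Matrix.mulVec_mulVec, symmetrizer_transpose_mulVec,
    ← Matrix.mulVec_mulVec, Matrix.dotProduct_mulVec, ← Matrix.mulVec_transpose,
    symmetrizer_transpose_mulVec, ← sum_flattening hk,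
    ← Fintype.sum_prod_type' (f := fun U V => (∏ t, ((x (U t) : ℤ) : ℝ)) *
      symmMatrix hk Φ U V * ∏ t, ((x (V t) : ℤ) : ℝ)),
    Finset.sum_pow', Fintype.piFinset_univ,
    ← ((Equiv.arrowProdEquivProdArrow (Fin d) (fun _ => Fin (k / 2) → Fin n)
      (fun _ => Fin (k / 2) → Fin n)).trans (Equiv.prodCongr (Equiv.curry _ _ _).symm
        (Equiv.curry _ _ _).symm)).symm.sum_comp, Fintype.sum_prod_type]
  simp only [dotProduct, Matrix.mulVec, Finset.mul_sum]
  refine Finset.sum_congr rfl fun I _ => Finset.sum_congr rfl fun J _ => ?_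
  rw [Finset.prod_mul_distrib, Finset.prod_mul_distrib, assignmentPower, assignmentPower,
    Fintype.prod_prod_type, Fintype.prod_prod_type, ← mul_assoc]
  rfl

theorem abs_sat_sub_le {k n d : ℕ} (hk : Even k) (hd : 1 ≤ d) (hdn : d ≤ n)
    (Φ : Instance k n) (hm : 0 < numConstraints Φ) (x : Fin n → ℤˣ) :
    |sat Φ x - 1 / 2| ≤ hsat hk d Φ - 1 / 2 := by
  have hm' : (0 : ℝ) < numConstraints Φ := by exact_mod_cast hm
  have hd0 : (d : ℝ) ≠ 0 := by positivity
  set asc : ℝ := ((k * d / 2 + n - 1)! : ℝ) / ((n - 1)! : ℝ) with hasc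
  have hsum : ∑ I : Index k d n, (histFactorial I : ℝ) = asc := by
    obtain ⟨r, rfl⟩ := hk
    obtain ⟨n, rfl⟩ : ∃ n', n = n' + 1 := ⟨n - 1, by omega⟩
    rw [← Nat.cast_sum, sum_histFactorial, hasc, eq_div_iff (by positivity)]
    have h1 : (r + r) * d / 2 = d * ((r + r) / 2) := by
      rw [show (r + r) * d = 2 * (d * r) by ring, show (r + r) / 2 = r by omega]
      omega
    rw [h1, Nat.add_sub_cancel, ← Nat.add_assoc, Nat.add_sub_cancel, mul_comm,
      Nat.add_comm _ n, ← Nat.factorial_mul_ascFactorial]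
    push_cast
    rfl
  set y : Index k d n → ℝ := assignmentPower x with hy
  -- The test vector Dy undoes the rescaling on both sides.
  set u : Index k d n → ℝ := fun I => √(histFactorial I : ℝ) * y I with hu
  have hs : ∀ I : Index k d n, √(histFactorial I : ℝ) ≠ 0 := fun I =>
    (Real.sqrt_pos.2 (by exact_mod_cast histFactorial_pos I)).ne'
  have h1 : u ⬝ᵥ rescaledMatrix hk d Φ *ᵥ u = y ⬝ᵥ higherMatrix hk d Φ *ᵥ y := by
    simp only [rescaledMatrix, histMatrix_inv, dotProduct, Matrix.mulVec, Matrix.mul_diagonal,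
      Matrix.diagonal_mul, hu, Finset.mul_sum]
    refine Finset.sum_congr rfl fun I _ => Finset.sum_congr rfl fun J _ => ?_
    have := hs I
    have := hs J
    field_simp
  have h2 : ∑ I, u I ^ 2 = asc := by
    rw [← hsum]
    refine Finset.sum_congr rfl fun I _ => ?_
    rw [hu, mul_pow, Real.sq_sqrt (by positivity), hy, assignmentPower_sq, mul_one]
  have h3 := abs_dotProduct_mulVec_le (rescaledMatrix hk d Φ) u
  rw [h1, h2, dotProduct_higherMatrix, sum_constraintsTensor_mul Φ x hm, abs_pow] at h3
  have hasc0 : 0 ≤ asc := by positivity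
  have h4 := Real.rpow_le_rpow (by positivity) h3 (by positivity : (0 : ℝ) ≤ 1 / d)
  rw [one_div (d : ℝ), Real.pow_rpow_inv_natCast (abs_nonneg _) (by omega),
    Real.mul_rpow (specNorm_nonneg _) hasc0, abs_mul, abs_of_pos (by positivity :
      (0 : ℝ) < 2 * numConstraints Φ)] at h4
  rw [hsat, add_sub_cancel_left, one_div (d : ℝ), one_div (2 * _), mul_assoc, inv_mul_eq_div,
    le_div_iff₀ (by positivity), mul_comm]
  exact h4

/-! ### The bound for random instances -/

/-- The bound for `‖R̃‖ ^ (1 / d)` given by the moment of order `2 * l`. -/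
def normBound (h n d l : ℕ) (p : ℝ) : ℝ :=
  Real.exp ((h + 1) / 2) * (Real.exp 1 / (d * h : ℕ)) ^ h * (2 * (d * l : ℕ)) *
    √(p * ((d * h * n : ℕ) : ℝ) ^ h / d)

theorem inv_factorial_le (N : ℕ) (hN : 0 < N) :
    1 / (N ! : ℝ) ≤ (Real.exp 1 / (N : ℝ)) ^ N := by
  have h := Real.pow_div_factorial_le_exp (x := (N : ℝ)) (by positivity) N
  rw [div_pow, ← Real.exp_nat_mul, mul_one]
  rw [div_le_iff₀ (by positivity)] at h
  rw [div_le_div_iff₀ (by positivity) (by positivity), one_mul]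
  exact h

theorem one_lt_mul_pow_div {h n d : ℕ} {p : ℝ} (hh : 1 ≤ h) (hd : 1 ≤ d)
    (hpd : 1 < p * (d : ℝ) ^ (h - 1) * (n : ℝ) ^ h) :
    p * ((d * h * n : ℕ) : ℝ) ^ h / d = ((d : ℝ) ^ (h - 1) * (n : ℝ) ^ h * p) * (h : ℝ) ^ h ∧
      1 < p * ((d * h * n : ℕ) : ℝ) ^ h / d := by
  have hd0 : (0 : ℝ) < d := by exact_mod_cast hd
  have h1 : p * ((d * h * n : ℕ) : ℝ) ^ h / d =
      ((d : ℝ) ^ (h - 1) * (n : ℝ) ^ h * p) * (h : ℝ) ^ h := by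
    obtain ⟨s, rfl⟩ := Nat.exists_eq_add_of_le' hh
    rw [Nat.add_sub_cancel]
    push_cast
    rw [mul_pow, mul_pow, pow_succ (d : ℝ)]
    field_simp
  refine ⟨h1, ?_⟩
  rw [h1]
  have h2 : (1 : ℝ) ≤ (h : ℝ) ^ h := one_le_pow₀ (by exact_mod_cast hh)
  nlinarith

/-- The leading factor n is the loss in Markov's inequality. Since n ≤ e^l, the factor n^(dh+1) is
at most e^(ld(h+1)), whose root of order 2ld is the constant e^((h+1)/2). -/
theorem moment_le_normBound_pow {h n d l : ℕ} {p : ℝ} (hh : 1 ≤ h) (hd : 1 ≤ d) (hn : 1 ≤ n)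
    (hnl : Real.log n ≤ l) (hp : 0 ≤ p) :
    (n : ℝ) * ((n : ℝ) ^ (d * h) * ((p * ((d * h * n : ℕ) : ℝ) ^ h / d) ^ (d * l) *
      ((2 * (d * l : ℕ)) ^ d / ((d * h)! : ℝ)) ^ (2 * l))) ≤
        (normBound h n d l p ^ d) ^ (2 * l) := by
  set q : ℝ := p * ((d * h * n : ℕ) : ℝ) ^ h / d with hq
  have hq0 : 0 ≤ q := by positivity
  have hnexp : (n : ℝ) ≤ Real.exp l := by
    rw [← Real.log_le_iff_le_exp (by exact_mod_cast hn)]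
    exact hnl
  have h1 : (n : ℝ) * (n : ℝ) ^ (d * h) ≤ (Real.exp ((h + 1) / 2)) ^ (d * (2 * l)) := by
    have h1n : (1 : ℝ) ≤ n := by exact_mod_cast hn
    calc (n : ℝ) * (n : ℝ) ^ (d * h) = (n : ℝ) ^ (d * h + 1) := by rw [pow_succ']
      _ ≤ (n : ℝ) ^ (d * (h + 1)) := pow_le_pow_right₀ h1n (by rw [mul_add]; omega)
      _ ≤ Real.exp l ^ (d * (h + 1)) := pow_le_pow_left₀ (by positivity) hnexp _
      _ = _ := by
        rw [← Real.exp_nat_mul, ← Real.exp_nat_mul]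
        congr 1
        push_cast
        ring
  have h2 : (1 / ((d * h)! : ℝ)) ^ (2 * l) ≤
      ((Real.exp 1 / (d * h : ℕ)) ^ h) ^ (d * (2 * l)) := by
    calc _ ≤ ((Real.exp 1 / ((d * h : ℕ) : ℝ)) ^ (d * h)) ^ (2 * l) :=
          pow_le_pow_left₀ (by positivity) (inv_factorial_le _ (by positivity)) _
      _ = _ := by
          rw [← pow_mul, ← pow_mul]
          congr 1
          ring
  have h3 : q ^ (d * l) = √q ^ (d * (2 * l)) := by
    rw [show d * (2 * l) = 2 * (d * l) by ring, pow_mul (√q), Real.sq_sqrt hq0]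
  have h4 : ((2 * (d * l : ℕ)) ^ d / ((d * h)! : ℝ)) ^ (2 * l) =
      (2 * ((d * l : ℕ) : ℝ)) ^ (d * (2 * l)) * (1 / ((d * h)! : ℝ)) ^ (2 * l) := by
    rw [div_eq_mul_one_div, mul_pow, ← pow_mul]
  rw [h3, h4, ← pow_mul, normBound, ← hq]
  calc _ = ((n : ℝ) * (n : ℝ) ^ (d * h)) * (1 / ((d * h)! : ℝ)) ^ (2 * l) *
        ((2 * ((d * l : ℕ) : ℝ)) ^ (d * (2 * l)) * √q ^ (d * (2 * l))) := by ring
    _ ≤ (Real.exp ((h + 1) / 2)) ^ (d * (2 * l)) *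
        ((Real.exp 1 / (d * h : ℕ)) ^ h) ^ (d * (2 * l)) *
        ((2 * ((d * l : ℕ) : ℝ)) ^ (d * (2 * l)) * √q ^ (d * (2 * l))) := by
        refine mul_le_mul_of_nonneg_right ?_ (by positivity)
        exact mul_le_mul h1 h2 (by positivity) (by positivity)
    _ = _ := by rw [← mul_pow, ← mul_pow, ← mul_pow, ← mul_assoc]

theorem measureReal_specNorm_gt_le {k n d j : ℕ} (hk : Even k) (hk0 : 0 < k) (hd : 1 ≤ d)
    (hn : 1 ≤ n) {p : ℝ} (h0 : 0 ≤ p) (h1 : p ≤ 1)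
    (hpd : 1 < p * (d : ℝ) ^ (k / 2 - 1) * (n : ℝ) ^ (k / 2))
    (hnj : Real.log n ≤ (2 ^ j : ℕ)) :
    (randomXOR k n p).real {Φ | normBound (k / 2) n d (2 ^ j) p ^ d <
      specNorm (rescaledMatrix hk d Φ)} ≤ 1 / n := by
  have := isProbabilityMeasure_randomXOR h0 h1 k n
  set h := k / 2 with hh
  have hh1 : 1 ≤ h := by obtain ⟨r, rfl⟩ := hk; omega
  set l : ℕ := 2 ^ j with hl
  have hl1 : 1 ≤ l := Nat.one_le_two_pow
  set B : ℝ := ((d * h * n : ℕ) : ℝ) ^ h with hB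
  have hd0 : (0 : ℝ) < d := by exact_mod_cast hd
  have hn0 : (0 : ℝ) < n := by exact_mod_cast hn
  have hB0 : 0 < B := by positivity
  have hq1 : 1 < p * B / d := (one_lt_mul_pow_div hh1 hd hpd).2
  set E : ℝ := (n : ℝ) ^ (d * h) * ((p * B / d) ^ (d * l) *
      ((2 * (d * l : ℕ)) ^ d / ((d * h)! : ℝ)) ^ (2 * l)) with hE
  have hE0 : 0 < E := by positivity
  -- With M = dl one has (pB/d)(M/B) = pl ≥ p; as pB/d > 1, raising it to the maximal exponent M
  -- serves every r ≤ M.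
  have hint := integral_trace_pow_le (t := 2 * l) (M := d * l) (z := (p * B / d) ^ (d * l))
    hk h0 h1 hB0 le_rfl (by ring) (by
      intro r hr
      have h2 : (p * B / d) ^ r ≤ (p * B / d) ^ (d * l) := pow_le_pow_right₀ hq1.le hr
      refine le_trans ?_ (mul_le_mul_of_nonneg_right h2 (by positivity))
      rw [← mul_pow]
      refine pow_le_pow_left₀ h0 ?_ r
      have : p * B / d * (((d * l : ℕ) : ℝ) / B) = p * l := by
        push_cast
        field_simp
      rw [this]
      exact le_mul_of_one_le_right h0 (by exact_mod_cast hl1))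
  have hfac : Fintype.card (Equiv.Perm (Pos k d)) = (d * h)! := by
    rw [Fintype.card_perm]
    simp [Pos, hh]
  simp only [hfac, ← hh] at hint
  have htr : ∀ Φ : Instance k n, specNorm (rescaledMatrix hk d Φ) ^ (2 * l) ≤
      ((symmetrizerGram k d n * kroneckerPower hk d Φ) ^ (2 * l)).trace := by
    intro Φ
    rw [← trace_rescaledMatrix_pow hk d Φ (by omega)]
    exact specNorm_pow_le_trace (rescaledMatrix_transpose hk d Φ) j
  have hmarkov := mul_meas_ge_le_integral_of_nonneg (μ := randomXOR k n p)
    (f := fun Φ => ((symmetrizerGram k d n * kroneckerPower hk d Φ) ^ (2 * l)).trace)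
    (Eventually.of_forall fun Φ => (pow_nonneg (specNorm_nonneg _) _).trans (htr Φ))
    Integrable.of_finite (n * E)
  have hsub : (randomXOR k n p).real {Φ | normBound h n d l p ^ d <
      specNorm (rescaledMatrix hk d Φ)} ≤ (randomXOR k n p).real {Φ | n * E ≤
        ((symmetrizerGram k d n * kroneckerPower hk d Φ) ^ (2 * l)).trace} := by
    refine measureReal_mono fun Φ hΦ => ?_
    simp only [Set.mem_ofPred_eq] at hΦ ⊢
    refine (moment_le_normBound_pow hh1 hd hn hnj h0).trans (le_trans ?_ (htr Φ))
    refine pow_le_pow_left₀ (pow_nonneg ?_ _) hΦ.le _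
    unfold normBound
    positivity
  have h3 := hmarkov.trans hint
  refine hsub.trans ?_
  rw [le_div_iff₀ hn0]
  have h4 : E * (n * (randomXOR k n p).real {Φ | n * E ≤
        ((symmetrizerGram k d n * kroneckerPower hk d Φ) ^ (2 * l)).trace}) ≤ E * 1 := by
    rw [mul_one]
    calc _ = n * E * (randomXOR k n p).real {Φ | n * E ≤
        ((symmetrizerGram k d n * kroneckerPower hk d Φ) ^ (2 * l)).trace} := by ring
      _ ≤ E := h3
  rw [mul_comm]
  exact le_of_mul_le_mul_left h4 hE0

/-- Each of the d(k/2) factors is at most n(k/2 + 1), because d ≤ n. -/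
theorem factorial_div_rpow_le {k n d : ℕ} (hk : Even k) (hd : 1 ≤ d) (hdn : d ≤ n) :
    (((k * d / 2 + n - 1)! : ℝ) / ((n - 1)! : ℝ)) ^ (1 / (d : ℝ)) ≤
      ((n : ℝ) * ((k / 2 : ℕ) + 1)) ^ (k / 2) := by
  obtain ⟨n, rfl⟩ : ∃ n', n = n' + 1 := ⟨n - 1, by omega⟩
  set h := k / 2 with hh
  have hN : k * d / 2 = d * h := by
    obtain ⟨r, rfl⟩ := hk
    rw [show (r + r) * d = 2 * (d * r) by ring, show h = r by omega]
    omega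
  have h1 : (((k * d / 2 + (n + 1) - 1)! : ℝ) / ((n + 1 - 1)! : ℝ)) ≤
      (((n + 1 : ℕ) * (h + 1) : ℝ) ^ h) ^ d := by
    rw [hN, Nat.add_sub_cancel, ← Nat.add_assoc, Nat.add_sub_cancel, div_le_iff₀ (by positivity),
      ← pow_mul]
    have h3 : (d * h + n)! ≤ n ! * (d * h + n) ^ (d * h) := by
      rw [Nat.add_comm (d * h)]
      rw [← Nat.factorial_mul_ascFactorial]
      exact Nat.mul_le_mul_left _ (Nat.ascFactorial_le_pow_add _ _)
    have h4 : d * h + n ≤ (n + 1) * (h + 1) := by nlinarith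
    have h5 : (d * h + n)! ≤ ((n + 1) * (h + 1)) ^ (h * d) * n ! := by
      rw [mul_comm _ (n !), mul_comm h d]
      exact h3.trans (Nat.mul_le_mul_left _ (Nat.pow_le_pow_left h4 _))
    exact_mod_cast h5
  refine (Real.rpow_le_rpow (by positivity) h1 (by positivity)).trans_eq ?_
  rw [one_div, Real.pow_rpow_inv_natCast (by positivity) (by omega)]

/-- The bound for the certified advantage, up to the absolute constant. -/
def advantageBound (k n d : ℕ) (p : ℝ) : ℝ :=
  (Real.log n / √((d : ℝ) ^ (k / 2 - 1) * (n : ℝ) ^ (k / 2) * p)) *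
    (Real.exp (3 * (k : ℝ) / 4) * ((k : ℝ) / 2 + 1) ^ ((k : ℝ) / 2) /
      ((k : ℝ) / 2) ^ ((k : ℝ) / 4))

theorem normBound_mul_le {k n d l : ℕ} {p : ℝ} (hk : Even k) (hk0 : 0 < k) (hd : 1 ≤ d)
    (hn : 1 ≤ n) (hpd : 1 < p * (d : ℝ) ^ (k / 2 - 1) * (n : ℝ) ^ (k / 2))
    (hl : (l : ℝ) ≤ 2 * Real.log n) :
    1 / ((n : ℝ) ^ k * p) * normBound (k / 2) n d l p *
      ((n : ℝ) * ((k / 2 : ℕ) + 1)) ^ (k / 2) ≤ 4 * Real.exp (1 / 2) * advantageBound k n d p := by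
  obtain ⟨h, rfl⟩ := hk
  have hhh : (h + h) / 2 = h := by omega
  rw [advantageBound]
  rw [hhh] at hpd ⊢
  have hh1 : 1 ≤ h := by omega
  have hd0 : (0 : ℝ) < d := by exact_mod_cast hd
  have hn0 : (0 : ℝ) < n := by exact_mod_cast hn
  have hh0 : (0 : ℝ) < h := by exact_mod_cast hh1
  have hc : ((h + h : ℕ) : ℝ) / 2 = h := by push_cast; ring
  have hp0 : 0 < p := by
    by_contra hneg
    have : p * ((d : ℝ) ^ (h - 1) * (n : ℝ) ^ h) ≤ 0 :=
      mul_nonpos_of_nonpos_of_nonneg (not_lt.1 hneg) (by positivity)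
    nlinarith
  obtain ⟨hq, -⟩ := one_lt_mul_pow_div hh1 hd hpd
  set a : ℝ := √((d : ℝ) ^ (h - 1) * (n : ℝ) ^ h * p) with ha
  have ha0 : 0 < a := Real.sqrt_pos.2 (by positivity)
  have ha2 : a ^ 2 = (d : ℝ) ^ (h - 1) * (n : ℝ) ^ h * p := Real.sq_sqrt (by positivity)
  set b : ℝ := √((h : ℝ) ^ h) with hb
  have hb0 : 0 < b := Real.sqrt_pos.2 (by positivity)
  have hb2 : b ^ 2 = (h : ℝ) ^ h := Real.sq_sqrt (by positivity)
  have hbr : ((h + h : ℕ) / 2 : ℝ) ^ (((h + h : ℕ) : ℝ) / 4) = b := by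
    rw [hc, hb, Real.sqrt_eq_rpow, ← Real.rpow_natCast, ← Real.rpow_mul hh0.le]
    congr 1
    push_cast
    ring
  have hr : (((h + h : ℕ) : ℝ) / 2 + 1) ^ (((h + h : ℕ) : ℝ) / 2) = ((h : ℝ) + 1) ^ h := by
    rw [hc, Real.rpow_natCast]
  -- Source of the e^{1/2} in the absolute constant; the 4 comes from 2l ≤ 4 log n.
  have he : Real.exp (3 * ((h + h : ℕ) : ℝ) / 4) * Real.exp (1 / 2) =
      Real.exp ((h + 1) / 2) * Real.exp 1 ^ h := by
    rw [← Real.exp_nat_mul, ← Real.exp_add, ← Real.exp_add]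
    congr 1
    push_cast
    ring
  rw [hbr, hr, normBound, hq, Real.sqrt_mul (by positivity), ← ha, ← hb]
  have hdpow : (d : ℝ) ^ h = d ^ (h - 1) * d := by
    rw [← pow_succ, Nat.sub_add_cancel hh1]
  have key : 1 / ((n : ℝ) ^ (h + h) * p) * (Real.exp ((h + 1) / 2) *
      (Real.exp 1 / (d * h : ℕ)) ^ h * (2 * (d * l : ℕ)) * (a * b)) * (n * (h + 1)) ^ h =
      (Real.exp ((h + 1) / 2) * Real.exp 1 ^ h) * (2 * l) * (h + 1 : ℝ) ^ h / (a * b) := by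
    rw [eq_div_iff (by positivity)]
    push_cast
    rw [div_pow, mul_pow (d : ℝ), mul_pow (n : ℝ), pow_add, hdpow, ← hb2]
    field_simp
    rw [ha2]
    ring
  rw [key, ← he]
  calc _ = (Real.exp (1 / 2) * Real.exp (3 * ((h + h : ℕ) : ℝ) / 4) * (h + 1 : ℝ) ^ h /
        (a * b) * 2) * l := by ring
    _ ≤ (Real.exp (1 / 2) * Real.exp (3 * ((h + h : ℕ) : ℝ) / 4) * (h + 1 : ℝ) ^ h /
        (a * b) * 2) * (2 * Real.log n) := mul_le_mul_of_nonneg_left hl (by positivity)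
    _ = _ := by
      field_simp
      ring

theorem measureReal_hsat_le {k n d : ℕ} (hk : Even k) (hk0 : 0 < k) (hd : 1 ≤ d) (hdn : d ≤ n)
    {p : ℝ} (h0 : 0 ≤ p) (h1 : p ≤ 1)
    (hpd : 1 < p * (d : ℝ) ^ (k / 2 - 1) * (n : ℝ) ^ (k / 2)) :
    1 - 5 / (n : ℝ) ≤ (randomXOR k n p).real {Φ | 0 < numConstraints Φ ∧
      hsat hk d Φ - 1 / 2 ≤ 4 * Real.exp (1 / 2) * advantageBound k n d p} := by
  have hprob := isProbabilityMeasure_randomXOR h0 h1 k n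
  have hn1 : 1 ≤ n := hd.trans hdn
  have hn0 : (0 : ℝ) < n := by exact_mod_cast hn1
  have hd0 : (0 : ℝ) < d := by exact_mod_cast hd
  -- For n < 5 the lower bound is not positive. From n = 5 on, log n ≥ 1, so some power of two lies
  -- in the range from log n to 2 log n.
  rcases lt_or_ge n 5 with hn5 | hn5
  · have : (1 : ℝ) ≤ 5 / n := by
      rw [le_div_iff₀ hn0, one_mul]
      exact_mod_cast hn5.le
    exact (by linarith : 1 - 5 / (n : ℝ) ≤ 0).trans measureReal_nonneg
  have hlog : 1 ≤ Real.log n := by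
    rw [Real.le_log_iff_exp_le hn0]
    have : (5 : ℝ) ≤ n := by exact_mod_cast hn5
    linarith [Real.exp_one_lt_d9]
  obtain ⟨j, hj1, hj2⟩ := exists_nat_pow_near hlog (by norm_num : (1 : ℝ) < 2)
  have hnj : Real.log n ≤ (2 ^ (j + 1) : ℕ) := by
    push_cast
    exact hj2.le
  have hjl : ((2 ^ (j + 1) : ℕ) : ℝ) ≤ 2 * Real.log n := by
    push_cast
    rw [pow_succ']
    linarith
  have hp0 : 0 < p := by
    rcases h0.lt_or_eq with h | h
    · exact h
    · rw [← h] at hpd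
      simp at hpd
      linarith
  -- The mean number of constraints is at least n because d ≤ n. Thus Chebyshev fails with
  -- probability at most 4/n, Markov with at most 1/n.
  have hμ : (n : ℝ) ≤ (n : ℝ) ^ k * p := by
    have hdn' : (d : ℝ) ^ (k / 2 - 1) ≤ (n : ℝ) ^ (k / 2 - 1) :=
      pow_le_pow_left₀ hd0.le (by exact_mod_cast hdn) _
    have hkk : (n : ℝ) ^ k = n * ((n : ℝ) ^ (k / 2 - 1) * (n : ℝ) ^ (k / 2)) := by
      rw [← pow_add, ← pow_succ']
      congr 1
      obtain ⟨r, rfl⟩ := hk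
      omega
    rw [hkk, mul_assoc]
    refine le_mul_of_one_le_right hn0.le (hpd.le.trans ?_)
    calc p * (d : ℝ) ^ (k / 2 - 1) * (n : ℝ) ^ (k / 2)
        ≤ p * (n : ℝ) ^ (k / 2 - 1) * (n : ℝ) ^ (k / 2) :=
          mul_le_mul_of_nonneg_right (mul_le_mul_of_nonneg_left hdn' h0) (by positivity)
      _ = _ := by ring
  have hμ0 : 0 < (n : ℝ) ^ k * p := hn0.trans_le hμ
  set bad₁ : Set (Instance k n) := {Φ | (numConstraints Φ : ℝ) < (n : ℝ) ^ k * p / 2}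
  set bad₂ : Set (Instance k n) := {Φ | normBound (k / 2) n d (2 ^ (j + 1)) p ^ d <
      specNorm (rescaledMatrix hk d Φ)}
  have hb1 : (randomXOR k n p).real bad₁ ≤ 4 / n :=
    (measureReal_numConstraints_lt_le h0 h1 hμ0).trans
      (div_le_div_of_nonneg_left (by norm_num) hn0 hμ)
  have hb2 : (randomXOR k n p).real bad₂ ≤ 1 / n :=
    measureReal_specNorm_gt_le hk hk0 hd hn1 h0 h1 hpd hnj
  have hbad : (randomXOR k n p).real (bad₁ ∪ bad₂) ≤ 5 / n := by
    refine (measureReal_union_le _ _).trans ((add_le_add hb1 hb2).trans_eq ?_)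
    ring
  have hcompl := probReal_compl_eq_one_sub (μ := randomXOR k n p) (s := bad₁ ∪ bad₂)
    (MeasurableSet.of_discrete)
  calc 1 - 5 / (n : ℝ) ≤ (randomXOR k n p).real (bad₁ ∪ bad₂)ᶜ := by rw [hcompl]; linarith
    _ ≤ _ := measureReal_mono fun Φ hΦ => ?_
  simp only [bad₁, bad₂, Set.mem_compl_iff, Set.mem_union, Set.mem_ofPred_eq, not_or,
    not_lt] at hΦ ⊢
  obtain ⟨hm, hs⟩ := hΦ
  have hm0 : (0 : ℝ) < numConstraints Φ := by linarith
  refine ⟨by exact_mod_cast hm0, ?_⟩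
  have hnb : 0 ≤ normBound (k / 2) n d (2 ^ (j + 1)) p := by
    unfold normBound
    positivity
  have hroot : specNorm (rescaledMatrix hk d Φ) ^ (1 / (d : ℝ)) ≤
      normBound (k / 2) n d (2 ^ (j + 1)) p := by
    refine (Real.rpow_le_rpow (specNorm_nonneg _) hs (by positivity)).trans_eq ?_
    rw [one_div, Real.pow_rpow_inv_natCast hnb (by omega)]
  rw [hsat, add_sub_cancel_left]
  refine le_trans ?_ (normBound_mul_le hk hk0 hd hn1 hpd hjl)
  have hm2 : 1 / (2 * (numConstraints Φ : ℝ)) ≤ 1 / ((n : ℝ) ^ k * p) :=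
    one_div_le_one_div_of_le hμ0 (by linarith)
  refine mul_le_mul (mul_le_mul hm2 hroot ?_ (by positivity)) (factorial_div_rpow_le hk hd hdn)
    (by positivity) (by positivity)
  exact Real.rpow_nonneg (specNorm_nonneg _) _

/-! ### Strong refutation -/

/-- Cancelling (n/d)^(k/2−1) turns the density assumption into log²n being negligible against the
quantity under the square root in `advantageBound`. -/
theorem pow_mul_eq {k n d : ℕ} (hk : Even k) (hk0 : 0 < k) (hd : 1 ≤ d) (p : ℝ) :
    (n : ℝ) ^ (k - 1) * p =
      ((n : ℝ) / d) ^ (k / 2 - 1) * ((d : ℝ) ^ (k / 2 - 1) * (n : ℝ) ^ (k / 2) * p) := by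
  have hd0 : (0 : ℝ) < d := by exact_mod_cast hd
  have h : k - 1 = (k / 2 - 1) + k / 2 := by obtain ⟨r, rfl⟩ := hk; omega
  rw [h, pow_add, div_pow]
  field_simp

theorem tendsto_log_sq : Tendsto (fun n : ℕ => Real.log n ^ 2) atTop atTop :=
  (tendsto_pow_atTop two_ne_zero).comp (Real.tendsto_log_atTop.comp tendsto_natCast_atTop_atTop)

section Asymptotic

variable {k : ℕ} {d : ℕ → ℕ} {p : ℕ → ℝ}

theorem eventually_log_sq_le (hk : Even k) (hk0 : 0 < k)
    (hd : ∀ n, 1 ≤ n → 1 ≤ d n ∧ d n ≤ n) (hp : ∀ n, 0 ≤ p n ∧ p n ≤ 1)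
    (ho : (fun n : ℕ => ((n : ℝ) / (d n : ℝ)) ^ (k / 2 - 1) * Real.log n ^ 2)
      =o[atTop] fun n : ℕ => (n : ℝ) ^ (k - 1) * p n) :
    ∀ᶠ n : ℕ in atTop, Real.log n ^ 2 ≤
        (d n : ℝ) ^ (k / 2 - 1) * (n : ℝ) ^ (k / 2) * p n ∧
      Real.log n ^ 2 ≤ (n : ℝ) ^ (k - 1) * p n := by
  filter_upwards [ho.bound one_pos, eventually_ge_atTop 1] with n hn hn1
  obtain ⟨hd1, hdn⟩ := hd n hn1
  have hd0 : (0 : ℝ) < d n := by exact_mod_cast hd1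
  have hn0 : (0 : ℝ) < n := by exact_mod_cast hn1
  have hp0 := (hp n).1
  have hr : (1 : ℝ) ≤ ((n : ℝ) / d n) ^ (k / 2 - 1) := by
    refine one_le_pow₀ ?_
    rw [le_div_iff₀ hd0, one_mul]
    exact_mod_cast hdn
  rw [one_mul, Real.norm_of_nonneg (by positivity), Real.norm_of_nonneg (by positivity)] at hn
  refine ⟨?_, (le_mul_of_one_le_left (sq_nonneg _) hr).trans hn⟩
  rw [pow_mul_eq hk hk0 hd1] at hn
  exact le_of_mul_le_mul_left hn (by linarith)

theorem tendsto_advantageBound (hk : Even k) (hk0 : 0 < k)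
    (hd : ∀ n, 1 ≤ n → 1 ≤ d n ∧ d n ≤ n)
    (ho : (fun n : ℕ => ((n : ℝ) / (d n : ℝ)) ^ (k / 2 - 1) * Real.log n ^ 2)
      =o[atTop] fun n : ℕ => (n : ℝ) ^ (k - 1) * p n) :
    Tendsto (fun n => advantageBound k n (d n) (p n)) atTop (𝓝 0) := by
  have h1 : Tendsto (fun n : ℕ =>
      Real.log n / √((d n : ℝ) ^ (k / 2 - 1) * (n : ℝ) ^ (k / 2) * p n)) atTop (𝓝 0) := by
    have h2 := (Real.continuous_sqrt.tendsto 0).comp ho.tendsto_div_nhds_zero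
    rw [Real.sqrt_zero] at h2
    refine h2.congr' ?_
    filter_upwards [eventually_ge_atTop 1] with n hn1
    obtain ⟨hd1, hdn⟩ := hd n hn1
    have hd0 : (0 : ℝ) < d n := by exact_mod_cast hd1
    have hn0 : (0 : ℝ) < n := by exact_mod_cast hn1
    rw [Function.comp_apply, pow_mul_eq hk hk0 hd1, mul_div_mul_left _ _ (by positivity),
      Real.sqrt_div (sq_nonneg _), Real.sqrt_sq (Real.log_natCast_nonneg n)]
  have h3 := h1.mul_const (Real.exp (3 * (k : ℝ) / 4) * ((k : ℝ) / 2 + 1) ^ ((k : ℝ) / 2) /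
      ((k : ℝ) / 2) ^ ((k : ℝ) / 4))
  rwa [zero_mul] at h3

/-- Stated for an arbitrary event implied by the finite bound, so that it serves both strong
refutation and the two-sided certificate. -/
theorem tendsto_measureReal_of_subset (hk : Even k) (hk0 : 0 < k)
    (hd : ∀ n, 1 ≤ n → 1 ≤ d n ∧ d n ≤ n) (hp : ∀ n, 0 ≤ p n ∧ p n ≤ 1)
    (ho : (fun n : ℕ => ((n : ℝ) / (d n : ℝ)) ^ (k / 2 - 1) * Real.log n ^ 2)
      =o[atTop] fun n : ℕ => (n : ℝ) ^ (k - 1) * p n)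
    (s : ∀ n, Set (Instance k n)) (hs : ∀ n, 1 ≤ n → ∀ Φ : Instance k n,
      0 < numConstraints Φ → hsat hk (d n) Φ - 1 / 2 ≤
        4 * Real.exp (1 / 2) * advantageBound k n (d n) (p n) → Φ ∈ s n) :
    Tendsto (fun n => (randomXOR k n (p n)).real (s n)) atTop (𝓝 1) := by
  have hlow : Tendsto (fun n : ℕ => 1 - 5 / (n : ℝ)) atTop (𝓝 1) := by
    simpa using (tendsto_const_div_atTop_nhds_zero_nat (5 : ℝ)).const_sub 1
  refine tendsto_of_tendsto_of_tendsto_of_le_of_le' hlow tendsto_const_nhds ?_ ?_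
  · filter_upwards [eventually_log_sq_le hk hk0 hd hp ho, eventually_ge_atTop 1,
      tendsto_log_sq.eventually_gt_atTop 1] with n hn hn1 hlog
    have := isProbabilityMeasure_randomXOR (hp n).1 (hp n).2 k n
    refine (measureReal_hsat_le hk hk0 (hd n hn1).1 (hd n hn1).2 (hp n).1 (hp n).2 ?_).trans
      (measureReal_mono fun Φ hΦ => hs n hn1 Φ hΦ.1 hΦ.2)
    linarith [hn.1]
  · refine Eventually.of_forall fun n => ?_
    have := isProbabilityMeasure_randomXOR (hp n).1 (hp n).2 k n
    exact measureReal_le_one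

end Asymptotic

theorem hsat_sub_half_nonneg {k n : ℕ} (hk : Even k) (d : ℕ) (Φ : Instance k n) :
    0 ≤ hsat hk d Φ - 1 / 2 := by
  have := specNorm_nonneg (rescaledMatrix hk d Φ)
  rw [hsat, add_sub_cancel_left]
  positivity

theorem numConstraints_eq_zero {k : ℕ} (hk0 : 0 < k) (Φ : Instance k 0) :
    numConstraints Φ = 0 := by
  rw [numConstraints, Finset.card_eq_zero]
  exact Finset.filter_eq_empty_iff.2 fun S => (S ⟨0, hk0⟩).elim0

end KXOR

end

theorem mainTheorem1 :
    -- validity of the certificate, for every instance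
    (∀ (k : ℕ) (hk : Even k), 0 < k → ∀ n d : ℕ, 1 ≤ d → d ≤ n →
      ∀ Φ : KXOR.Instance k n, 0 < KXOR.numConstraints Φ → ∀ x : Fin n → ℤˣ,
        |KXOR.sat Φ x - 1 / 2| ≤ KXOR.hsat hk d Φ - 1 / 2) ∧
    -- the bound for random instances, with absolute constants `c` and `C`
    (∃ c C : ℝ, 0 < c ∧ 0 < C ∧
      ∀ (k : ℕ) (hk : Even k), 0 < k → ∀ n d : ℕ, 1 ≤ d → d ≤ n →
      ∀ p : ℝ, 0 ≤ p → p ≤ 1 → 1 < p * (d : ℝ) ^ (k / 2 - 1) * (n : ℝ) ^ (k / 2) →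
        1 - C / (n : ℝ) ≤ (KXOR.randomXOR k n p).real
          {Φ | 0 < KXOR.numConstraints Φ ∧
            KXOR.hsat hk d Φ - 1 / 2 ≤
              c * (Real.log n / √((d : ℝ) ^ (k / 2 - 1) * (n : ℝ) ^ (k / 2) * p)) *
                (Real.exp (3 * (k : ℝ) / 4) * ((k : ℝ) / 2 + 1) ^ ((k : ℝ) / 2) /
                  ((k : ℝ) / 2) ^ ((k : ℝ) / 4))}) ∧
    -- strong refutation and the two-sided certificate above the density threshold
    (∀ (k : ℕ) (hk : Even k), 0 < k → ∀ (d : ℕ → ℕ) (p : ℕ → ℝ),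
      (∀ n, 1 ≤ n → 1 ≤ d n ∧ d n ≤ n) → (∀ n, 0 ≤ p n ∧ p n ≤ 1) →
      ((fun n : ℕ => ((n : ℝ) / (d n : ℝ)) ^ (k / 2 - 1) * Real.log n ^ 2)
        =o[atTop] fun n : ℕ => (n : ℝ) ^ (k - 1) * p n) →
        KXOR.StronglyRefutes k (fun n Φ => KXOR.hsat hk (d n) Φ) p ∧
        ∃ ε : ℕ → ℝ, Tendsto ε atTop (𝓝 0) ∧
          Tendsto (fun n : ℕ => (KXOR.randomXOR k n (p n)).real
            {Φ | 0 < KXOR.numConstraints Φ ∧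
              (∀ x : Fin n → ℤˣ, |KXOR.sat Φ x - 1 / 2| ≤ KXOR.hsat hk (d n) Φ - 1 / 2) ∧
              KXOR.hsat hk (d n) Φ - 1 / 2 ≤ ε n}) atTop (𝓝 1)) := by
  refine ⟨fun k hk _ n d hd hdn Φ hm x => KXOR.abs_sat_sub_le hk hd hdn Φ hm x,
    ⟨4 * Real.exp (1 / 2), 5, by positivity, by norm_num,
      fun k hk hk0 n d hd hdn p h0 h1 hpd => ?_⟩, fun k hk hk0 d p hd hp ho => ⟨⟨?_, ?_, ?_⟩, ?_⟩⟩
  · have h := KXOR.measureReal_hsat_le hk hk0 hd hdn h0 h1 hpd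
    simpa only [KXOR.advantageBound, mul_assoc] using h
  · refine tendsto_atTop_mono' _ ?_ KXOR.tendsto_log_sq
    exact (KXOR.eventually_log_sq_le hk hk0 hd hp ho).mono fun n hn => hn.2
  · intro n Φ hm x
    -- Nothing is assumed of d at n = 0, but as k > 0 there are no scopes, hence no nonempty
    -- instance.
    rcases Nat.eq_zero_or_pos n with rfl | hn
    · rw [KXOR.numConstraints_eq_zero hk0] at hm
      exact absurd hm (lt_irrefl 0)
    · have h := KXOR.abs_sat_sub_le hk (hd n hn).1 (hd n hn).2 Φ hm x
      linarith [le_abs_self (KXOR.sat Φ x - 1 / 2)]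
  · refine ⟨fun n => 4 * Real.exp (1 / 2) * KXOR.advantageBound k n (d n) (p n), ?_, ?_⟩
    · simpa using (KXOR.tendsto_advantageBound hk hk0 hd ho).const_mul (4 * Real.exp (1 / 2))
    · refine KXOR.tendsto_measureReal_of_subset hk hk0 hd hp ho _ fun n _ Φ hm hΦ => ⟨hm, ?_⟩
      rwa [abs_of_nonneg (KXOR.hsat_sub_half_nonneg hk _ Φ)]
  · refine ⟨fun n => 4 * Real.exp (1 / 2) * KXOR.advantageBound k n (d n) (p n), ?_, ?_⟩
    · simpa using (KXOR.tendsto_advantageBound hk hk0 hd ho).const_mul (4 * Real.exp (1 / 2))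
    · exact KXOR.tendsto_measureReal_of_subset hk hk0 hd hp ho _ fun n hn Φ hm hΦ =>
        ⟨hm, fun x => KXOR.abs_sat_sub_le hk (hd n hn).1 (hd n hn).2 Φ hm x, hΦ⟩
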